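/- **Setting.** Let $(D,\mathcal M,\mu)$ be a measure space, $p\in(1,\infty)$, $X=L^p(D,\mathcal M,\mu)$ with the a.e. order, $K_+=\{x\in X:x\ge 0\}$, $X^*$ the topological dual of $X$ with pairing $\langle\cdot,\cdot\rangle$, and $K_+^*=\{\varphi\in X^*:\langle\varphi,x\rangle\ge0\ \forall x\in K_+\}$. Let $\mathcal A$ be a linear operator on $X$ generating a $C_0$-group $(e^{t\mathcal A})_{t\in\mathbb R}$ of positivity-preserving bounded operators, and let $e^{t\mathcal A^*}=(e^{t\mathcal A})^*$. Let $0\le T\le\infty$ (with $[0,T]=[0,\infty)$ if $T=\infty$), let $(\Omega,\mathcal F,(\mathcal F_t)_{t\in[0,T]},\mathsf P)$ be a filtered probability space satisfying the usual conditions, $q$ a finite Borel measure on $[0,T]$, $\Pi:\Omega\times[0,T]\times K_+\to[0,\infty)$ measurable, $\Phi^*$ an adapted $K_+^*$-valued process with càdlàg paths, and $\mathbf y\in K_+$. Pathwise properties are understood $\mathsf P$-almost surely. Let $\mathcal S$ be the set of adapted processes $\nu:\Omega\times[0,T]\to K_+$ whose paths are nondecreasing, right-continuous and of finite variation in $X$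 on $[0,t]$ for every finite $t\in[0,T]$; put $\nu_{0^-}=0$. For $\nu\in\mathcal S$ let $|\nu|$ be the variation measure of $\mathrm d\nu$ (with mass $|\nu_0|_X$ at $0$) and $\rho$ the $K_+$-valued, locally Bochner integrable density with $\mathrm d\nu=\rho\,\mathrm d|\nu|$. For strongly continuous $\Theta$ with values in the bounded operators on $X$, and for a $K_+^*$-valued process $f^*$ with càdlàg paths, set $$\int_0^t\Theta(s)\,\mathrm d\nu_s:=\int_{[0,t]}\Theta(s)\rho_s\,\mathrm d|\nu|_s,\qquad \int_0^T\langle f^*_s,\mathrm d\nu_s\rangle:=\int_{[0,T]}\langle f^*_s,\rho_s\rangle\,\mathrm d|\nu|_s\in[0,\infty].$$ *Original problem.* Let $\mathcal C=\{\nu\in\mathcal S:\mathsf E[\int_0^T\langle\Phi^*_t,\mathrm d\nu_t\rangle]<\infty\}$ and, for $\nu\in\mathcal C$, let $Y^{\mathbf y,\nu}_t=e^{t\mathcal A}\mathbf y+\int_0^te^{(t-s)\mathcal A}\,\mathrm d\nu_s$ and $$\mathcal J(\mathbf y,\nu)=\mathsf E\Big[\int_0^T\Pi(t,Y_t^{\mathbf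 y,\nu})\,q(\mathrm dt)-\int_0^T\langle\Phi^*_t,\mathrm d\nu_t\rangle\Big]\in(-\infty,\infty].$$ A control $\nu^\star\in\mathcal C$ is optimal if $\mathcal J(\mathbf y,\nu^\star)=\sup_{\nu\in\mathcal C}\mathcal J(\mathbf y,\nu)$. *Group-reformulated problem.* Let $\widehat{\mathcal C}=\{\widehat\nu\in\mathcal S:\mathsf E[\int_0^T\langle e^{t\mathcal A^*}\Phi^*_t,\mathrm d\widehat\nu_t\rangle]<\infty\}$ and, for $\widehat\nu\in\widehat{\mathcal C}$, let $\widehat Y^{\mathbf y,\widehat\nu}_t=\mathbf y+\widehat\nu_t$ and $$\widehat{\mathcal J}(\mathbf y,\widehat\nu)=\mathsf E\Big[\int_0^T\Pi\big(t,e^{t\mathcal A}\widehat Y_t^{\mathbf y,\widehat\nu}\big)\,q(\mathrm dt)-\int_0^T\langle e^{t\mathcal A^*}\Phi^*_t,\mathrm d\widehat\nu_t\rangle\Big].$$ A control $\widehat\nu^\star\in\widehat{\mathcal C}$ is optimal if $\widehat{\mathcal J}(\mathbf y,\widehat\nu^\star)=\sup_{\widehat\nu\in\widehat{\mathcal C}}\widehat{\mathcal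 J}(\mathbf y,\widehat\nu)$. **Proposition 4.2.** Suppose that $\widehat\nu^\star\in\widehat{\mathcal C}$ is optimal for the group-reformulated problem. Then $\nu^\star_t:=\int_0^te^{s\mathcal A}\,\mathrm d\widehat\nu^\star_s$ belongs to $\mathcal C$ and is optimal for the original problem, and its state process is $e^{t\mathcal A}\widehat Y^{\mathbf y,\widehat\nu^\star}_t$; that is, $\mathsf P$-a.s., $Y^{\mathbf y,\nu^\star}_t=e^{t\mathcal A}\widehat Y^{\mathbf y,\widehat\nu^\star}_t$ for all $t\in[0,T]$. -/

import Mathlib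

open MeasureTheory Set Filter Topology
open scoped ENNReal NNReal

namespace SingularControl

noncomputable section

/-- The time interval `[0, T]` for `0 ≤ T ≤ ∞`; for `T = ∞` it is `[0, ∞)`. -/
def horizon (T : ℝ≥0∞) : Set ℝ≥0 := {t | (t : ℝ≥0∞) ≤ T}

instance (T : ℝ≥0∞) : (horizon T).OrdConnected :=
  ⟨fun _ _ _ hy _ hz => le_trans (ENNReal.coe_le_coe.2 hz.2) hy⟩

/-- `[0, T]` as a type, with the order, topology and Borel sigma-algebra inherited from
`[0, ∞)`. -/
abbrev Time (T : ℝ≥0∞) : Type := horizon T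

/-- The initial time `0`. -/
def Time.zero (T : ℝ≥0∞) : Time T := ⟨0, by simp [horizon]⟩

/-- The real number underlying a time. -/
def Time.toReal {T : ℝ≥0∞} (t : Time T) : ℝ := ((t : ℝ≥0) : ℝ)

/-! ### The group generated by an operator -/

section Group

variable {E : Type*} [NormedAddCommGroup E] [NormedSpace ℝ E] [PartialOrder E]

/-- `U = (e^{tA})_{t ∈ ℝ}` is a strongly continuous group of positivity-preserving bounded
operators on `E`, and the (in general unbounded) linear operator `A` is its generator:
`x ∈ D(A)` with `A x = z` exactly when `(U_h x - x) / h → z` as `h → 0`.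
(The generator of a strongly continuous group is closed and densely defined, and it
determines the group.) -/
structure GeneratesPositiveGroup (A : E →ₗ.[ℝ] E) (U : ℝ → E →L[ℝ] E) : Prop where
  map_zero : U 0 = ContinuousLinearMap.id ℝ E
  map_add : ∀ s t : ℝ, U (s + t) = (U s).comp (U t)
  strong_continuous : ∀ x : E, Continuous fun t : ℝ => U t x
  positive : ∀ (t : ℝ) (x : E), 0 ≤ x → 0 ≤ U t x
  generator : ∀ x z : E, (x, z) ∈ A.graph ↔
    Tendsto (fun h : ℝ => h⁻¹ • (U h x - x)) (𝓝[≠] 0) (𝓝 z)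

end Group

/-! ### Integration with respect to a monotone path -/

section Paths

variable {T : ℝ≥0∞} {E : Type*} [NormedAddCommGroup E] [NormedSpace ℝ E] [PartialOrder E]

/-- The paths of controls: nonnegative, nondecreasing, right-continuous, and of finite variation
on every compact interval `[0, t]`, `t < ∞`. -/
structure IsControlPath (f : Time T → E) : Prop where
  nonneg : ∀ t, 0 ≤ f t
  mono : Monotone f
  right_continuous : ∀ t, ContinuousWithinAt f (Ici t) t
  finite_variation : LocallyBoundedVariationOn f univ

/-- `df = ρ d|f|` : `m` is the variation measure `|f|` of the vector measure `df` on `[0, T]`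
determined by `df([0, t]) = f t` (so that, with the convention `f (0-) = 0`, there is an atom at
`0` with mass `f 0`), and `ρ` is a nonnegative, (locally) Bochner integrable density of `df`
with respect to it. -/
structure IsPolar (f : Time T → E) (m : Measure (Time T)) (ρ : Time T → E) : Prop where
  variation : ∀ t, m (Iic t) = ‖f (Time.zero T)‖ₑ + eVariationOn f (Iic t)
  measurable : StronglyMeasurable ρ
  nonneg : ∀ t, 0 ≤ ρ t
  integrable : ∀ t, IntegrableOn ρ (Iic t) m
  density : ∀ t, ∫ s in Iic t, ρ s ∂m = f t

open scoped Classical in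
/-- The pair `(|f|, ρ)` with `df = ρ d|f|`. The measure is unique and `ρ` is unique almost
everywhere, so no integral below depends on the choice. -/
def polar (f : Time T → E) : Measure (Time T) × (Time T → E) :=
  if h : ∃ mρ : Measure (Time T) × (Time T → E), IsPolar f mρ.1 mρ.2 then h.choose else (0, 0)

/-- The variation measure `|f|`. -/
def variationMeasure (f : Time T → E) : Measure (Time T) := (polar f).1

/-- The density `ρ = df / d|f|`. -/
def polarDensity (f : Time T → E) : Time T → E := (polar f).2

/-- `∫_0^t Θ(s) df_s := ∫_{[0,t]} Θ(s) ρ_s d|f|_s`, a Bochner integral in `E`. -/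
def opIntegral (Θ : Time T → E →L[ℝ] E) (f : Time T → E) (t : Time T) : E :=
  ∫ s in Iic t, Θ s (polarDensity f s) ∂(variationMeasure f)

/-- `∫_0^T ⟨g_s, df_s⟩ := ∫_{[0,T]} ⟨g_s, ρ_s⟩ d|f|_s ∈ [0, ∞]`, for `g` with values in the
nonnegative cone of the dual space. -/
def pairIntegral (g : Time T → StrongDual ℝ E) (f : Time T → E) : ℝ≥0∞ :=
  ∫⁻ s, ENNReal.ofReal (g s (polarDensity f s)) ∂(variationMeasure f)

end Paths

/-! ### Stochastic setting -/

section Stochastic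

variable {T : ℝ≥0∞} {Ω : Type*} {mΩ : MeasurableSpace Ω}

/-- The usual conditions: the filtration is right-continuous and every `P`-null set belongs to
every `𝓕 t`. -/
structure UsualConditions (𝓕 : Filtration (Time T) mΩ) (P : Measure Ω) : Prop where
  right_continuous : 𝓕.IsRightContinuous
  complete : ∀ (s : Set Ω), P s = 0 → ∀ t, MeasurableSet[𝓕 t] s

/-- Right-continuous with left limits. -/
def IsCadlag {F : Type*} [TopologicalSpace F] (g : Time T → F) : Prop :=
  ∀ t, ContinuousWithinAt g (Ici t) t ∧ ∃ l, Tendsto g (𝓝[<] t) (𝓝 l)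

variable {E : Type*} [NormedAddCommGroup E] [NormedSpace ℝ E] [PartialOrder E]

/-- The marginal-cost process `Φ*`: adapted, with values in the nonnegative cone of the dual space
and with càdlàg paths (almost surely). -/
structure IsCostProcess (𝓕 : Filtration (Time T) mΩ) (P : Measure Ω)
    (Φ : Time T → Ω → StrongDual ℝ E) : Prop where
  adapted : StronglyAdapted 𝓕 Φ
  nonneg : ∀ᵐ ω ∂P, ∀ (t : Time T) (x : E), 0 ≤ x → 0 ≤ Φ t ω x
  cadlag : ∀ᵐ ω ∂P, IsCadlag fun t => Φ t ω

/-- The set `𝒮` of controls: adapted processes almost all of whose paths are control paths. -/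
structure IsControl (𝓕 : Filtration (Time T) mΩ) (P : Measure Ω) (ν : Time T → Ω → E) : Prop where
  adapted : StronglyAdapted 𝓕 ν
  paths : ∀ᵐ ω ∂P, IsControlPath fun t => ν t ω

/-- The total cost `∫_0^T ⟨Φ_t, dν_t⟩`, a random variable with values in `[0, ∞]`. -/
def totalCost (Φ : Time T → Ω → StrongDual ℝ E) (ν : Time T → Ω → E) (ω : Ω) : ℝ≥0∞ :=
  pairIntegral (fun t => Φ t ω) (fun t => ν t ω)

/-- The controls `ν ∈ 𝒮` with `E[∫_0^T ⟨Φ_t, dν_t⟩] < ∞`. -/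
def admissible (𝓕 : Filtration (Time T) mΩ) (P : Measure Ω) (Φ : Time T → Ω → StrongDual ℝ E) :
    Set (Time T → Ω → E) :=
  {ν | IsControl 𝓕 P ν ∧ ∫⁻ ω, totalCost Φ ν ω ∂P < ∞}

/-- Expected net profit `E[∫_0^T profit(t, Y_t) q(dt) - ∫_0^T ⟨Φ_t, dν_t⟩]`, for a state process `Y` and
a control `ν`. The profit term is nonnegative and the cost term is nonnegative with finite
expectation for admissible `ν`, so the expectation exists in `(-∞, ∞]` and is the difference
of the two expectations. -/
def netProfit (P : Measure Ω) (q : Measure (Time T)) (profit : Ω → Time T → E → ℝ≥0)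
    (Φ : Time T → Ω → StrongDual ℝ E) (Y ν : Time T → Ω → E) : EReal :=
  ((∫⁻ ω, ∫⁻ t, (profit ω t (Y t ω) : ℝ≥0∞) ∂q ∂P : ℝ≥0∞) : EReal)
    - ((∫⁻ ω, totalCost Φ ν ω ∂P : ℝ≥0∞) : EReal)

/-- The mild solution `Y_t = e^{tA} y + ∫_0^t e^{(t-s)A} dν_s` of `dY = A Y dt + dν`, `Y_{0-} = y`. -/
def mildState (U : ℝ → E →L[ℝ] E) (y : E) (ν : Time T → Ω → E) (t : Time T) (ω : Ω) : E :=
  U t.toReal y + opIntegral (fun s => U (t.toReal - s.toReal)) (fun s => ν s ω) t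

/-- The performance criterion `𝒥(y, ν)` of the original problem. -/
def performance (P : Measure Ω) (q : Measure (Time T)) (profit : Ω → Time T → E → ℝ≥0)
    (Φ : Time T → Ω → StrongDual ℝ E) (U : ℝ → E →L[ℝ] E) (y : E) (ν : Time T → Ω → E) : EReal :=
  netProfit P q profit Φ (mildState U y ν) ν

/-- The process `e^{tA*} Φ_t`, where `e^{tA*} = (e^{tA})*` is the adjoint (transpose) operator. -/
def adjointCost (U : ℝ → E →L[ℝ] E) (Φ : Time T → Ω → StrongDual ℝ E) :
    Time T → Ω → StrongDual ℝ E :=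
  fun t ω => (Φ t ω).comp (U t.toReal)

/-- The state `Ŷ_t = y + ν̂_t` of the group-reformulated problem. -/
def hatState (y : E) (ν : Time T → Ω → E) (t : Time T) (ω : Ω) : E := y + ν t ω

/-- The performance criterion of the group-reformulated problem,
`E[∫_0^T profit(t, e^{tA} Ŷ_t) q(dt) - ∫_0^T ⟨e^{tA*} Φ_t, dν̂_t⟩]`. -/
def hatPerformance (P : Measure Ω) (q : Measure (Time T)) (profit : Ω → Time T → E → ℝ≥0)
    (Φ : Time T → Ω → StrongDual ℝ E) (U : ℝ → E →L[ℝ] E) (y : E) (ν : Time T → Ω → E) : EReal :=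
  netProfit P q profit (adjointCost U Φ) (fun t ω => U t.toReal (hatState y ν t ω)) ν

/-- The control `ν_t = ∫_0^t e^{sA} dν̂_s` obtained from `ν̂`. -/
def controlOfHat (U : ℝ → E →L[ℝ] E) (νhat : Time T → Ω → E) (t : Time T) (ω : Ω) : E :=
  opIntegral (fun s => U s.toReal) (fun s => νhat s ω) t

/-- `ν` is optimal for the problem `sup_{ν ∈ C} J(ν)`: it lies in `C` and attains the supremum. -/
def IsOptimal (C : Set (Time T → Ω → E)) (J : (Time T → Ω → E) → EReal) (ν : Time T → Ω → E) :
    Prop :=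
  ν ∈ C ∧ J ν = ⨆ ν' ∈ C, J ν'

end Stochastic

/-- Joint measurability of `profit : Ω × [0, T] × K₊ → [0, ∞)`, where `K₊ = {x ≥ 0}` carries its
Borel sigma-algebra. (Values of `profit` off the cone `K₊` play no role.) -/
def IsProfitFunction {T : ℝ≥0∞} {Ω : Type*} [MeasurableSpace Ω] {E : Type*}
    [NormedAddCommGroup E] [PartialOrder E] (profit : Ω → Time T → E → ℝ≥0) : Prop :=
  letI : MeasurableSpace {x : E // 0 ≤ x} := borel _
  Measurable fun a : Ω × Time T × {x : E // 0 ≤ x} => profit a.1 a.2.1 a.2.2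

end

end SingularControl

namespace SingularControl

/-! The maps `controlOfHat` (`dν = e^{sA} dν̂`) and `hatOfControl` (`dν̂ = e^{-sA} dν`) carry the
admissible controls of each problem into those of the other, preserving state and cost pathwise:
`e^{(t-s)A} e^{sA} = e^{tA}`, and the adjoint moves `e^{sA}` between the cost and the control. Both
criteria are therefore preserved, so for any admissible `ν` the value `𝒥(ν) = Ĵ(hatOfControl ν)` is
at most the optimal hat value, which is `𝒥(controlOfHat ν̂)`.

The work lies in making this calculus legitimate. (a) Every control path needs a pair `(|f|, ρ)`.
This is a Radon-Nikodym theorem (`exists_density`): averages over finer and finer partitions form a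
martingale, and uniform convexity of the `L^p` norm makes it Cauchy in `L¹`. (b) If `df = ρ d|f|`,
then `Θρ` is a density of `∫ Θ df` with respect to `|f|`, not with respect to its own variation
measure. `exists_common_density` shows that integrals linear in the density do not see the
difference. (c) The transformed control must be adapted although its density is chosen path by path.
Riemann sums (`tendsto_riemannSum`) express it through the original control at earlier times. -/

theorem integrable_of_stronglyMeasurable_of_norm_le_one {α E : Type*} [MeasurableSpace α]
    [NormedAddCommGroup E] {m : Measure α} [IsFiniteMeasure m] {g : α → E}
    (hg : StronglyMeasurable g) (hb : ∀ a, ‖g a‖ ≤ 1) : Integrable g m :=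
  Integrable.of_bound hg.aestronglyMeasurable 1 (Eventually.of_forall hb)

theorem integrable_norm_rpow_of_norm_le_one {α E : Type*} [MeasurableSpace α]
    [NormedAddCommGroup E] {m : Measure α} [IsFiniteMeasure m] {g : α → E}
    (hg : StronglyMeasurable g) (hb : ∀ a, ‖g a‖ ≤ 1) {r : ℝ} (hr : 1 ≤ r) :
    Integrable (fun a => ‖g a‖ ^ r) m := by
  refine integrable_of_stronglyMeasurable_of_norm_le_one ?_ fun a => ?_
  · exact (continuous_norm.rpow_const fun _ => Or.inr (by linarith)).comp_stronglyMeasurable hg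
  · rw [Real.norm_of_nonneg (by positivity)]
    exact Real.rpow_le_one (norm_nonneg _) (hb a) (by linarith)

theorem convexOn_norm_rpow {E : Type*} [NormedAddCommGroup E] [NormedSpace ℝ E] {r : ℝ}
    (hr : 1 ≤ r) : ConvexOn ℝ univ fun x : E => ‖x‖ ^ r := by
  refine ⟨convex_univ, fun x _ y _ a b ha hb hab => ?_⟩
  have h1 : ‖a • x + b • y‖ ≤ a * ‖x‖ + b * ‖y‖ := by
    refine (norm_add_le _ _).trans (le_of_eq ?_)
    rw [norm_smul, norm_smul, Real.norm_of_nonneg ha, Real.norm_of_nonneg hb]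
  exact (Real.rpow_le_rpow (norm_nonneg _) h1 (by linarith)).trans
    ((convexOn_rpow hr).2 (norm_nonneg x) (norm_nonneg y) ha hb hab)

/-! ### Radon-Nikodym theorem for dominated vector measures. -/

section VectorDensity

open MeasurableSpace ProbabilityTheory

variable {α : Type*} [MeasurableSpace α] [CountablyGenerated α]
  {E : Type*} [NormedAddCommGroup E] [NormedSpace ℝ E]

/-- The average of the vector measure `ν` with respect to `m` over the cells of the `n`-th
countable partition. -/
noncomputable def partitionDensity (m : Measure α) (ν : VectorMeasure α E) (n : ℕ) (a : α) : E :=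
  (m.real (countablePartitionSet n a))⁻¹ • ν (countablePartitionSet n a)

theorem stronglyMeasurable_partitionDensity (m : Measure α) (ν : VectorMeasure α E) (n : ℕ) :
    StronglyMeasurable[countableFiltration α n] (partitionDensity m ν n) := by
  let _ : MeasurableSpace (countablePartition α n) := ⊤
  have hfin : Finite (countablePartition α n) := (finite_countablePartition α n).to_subtype
  have h := measurable_countablePartitionSet_subtype (α := α) n ⊤
  exact (StronglyMeasurable.of_discrete (f := fun I : countablePartition α n =>
    (m.real (I : Set α))⁻¹ • ν (I : Set α))).comp_measurable h

variable {m : Measure α} {ν : VectorMeasure α E}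

theorem norm_partitionDensity_le (hν : ∀ B, ‖ν B‖ ≤ m.real B) (n : ℕ) (a : α) :
    ‖partitionDensity m ν n a‖ ≤ 1 := by
  rw [partitionDensity, norm_smul, norm_inv, Real.norm_of_nonneg measureReal_nonneg,
    inv_mul_eq_div]
  exact div_le_one_of_le₀ (hν _) measureReal_nonneg

theorem integrable_partitionDensity [IsFiniteMeasure m] (hν : ∀ B, ‖ν B‖ ≤ m.real B) (n : ℕ) :
    Integrable (partitionDensity m ν n) m :=
  integrable_of_stronglyMeasurable_of_norm_le_one
    ((stronglyMeasurable_partitionDensity m ν n).mono ((countableFiltration α).le n))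
    (norm_partitionDensity_le hν n)

variable [CompleteSpace E]

theorem setIntegral_partitionDensity_of_mem (hν : ∀ B, ‖ν B‖ ≤ m.real B) (n : ℕ) {I : Set α}
    (hI : I ∈ countablePartition α n) : ∫ a in I, partitionDensity m ν n a ∂m = ν I := by
  have hIm := measurableSet_countablePartition n hI
  have hc : ∀ a ∈ I, partitionDensity m ν n a = (m.real I)⁻¹ • ν I := fun a ha => by
    rw [partitionDensity, countablePartitionSet_of_mem hI ha]
  rw [setIntegral_congr_fun hIm hc, setIntegral_const, smul_smul]
  rcases eq_or_ne (m.real I) 0 with h0 | h0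
  -- On a null cell the average is `0` by the convention for inverses, and domination forces `ν I =
  -- 0` too.
  · have : ν I = 0 := norm_le_zero_iff.1 (h0 ▸ hν I)
    simp [this]
  · rw [mul_inv_cancel₀ h0, one_smul]

variable [IsFiniteMeasure m]

theorem setIntegral_partitionDensity (hν : ∀ B, ‖ν B‖ ≤ m.real B) (n : ℕ) {B : Set α}
    (hB : MeasurableSet[countableFiltration α n] B) :
    ∫ a in B, partitionDensity m ν n a ∂m = ν B := by
  obtain ⟨S, hS, rfl⟩ := (measurableSet_generateFrom_countablePartition_iff _ _).1 hB
  have hm : ∀ I ∈ S, MeasurableSet I := fun I hI => measurableSet_countablePartition n (hS hI)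
  have hd : (S : Set (Set α)).PairwiseDisjoint id := fun I hI J hJ hIJ =>
    disjoint_countablePartition (hS hI) (hS hJ) hIJ
  have hU : ⋃₀ (S : Set (Set α)) = ⋃ I ∈ S, I := by simp [sUnion_eq_biUnion]
  rw [hU, integral_biUnion_finset S hm hd
    (fun I _ => (integrable_partitionDensity hν n).integrableOn),
    VectorMeasure.of_biUnion_finset (f := fun I => I) hd hm]
  exact Finset.sum_congr rfl fun I hI => setIntegral_partitionDensity_of_mem hν n (hS hI)

/-- The partition average is the conditional expectation of any such `g`, so this is conditional
Jensen for `‖·‖ ^ r`. -/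
theorem integral_norm_rpow_partitionDensity_le (hν : ∀ B, ‖ν B‖ ≤ m.real B) {r : ℝ} (hr : 1 ≤ r)
    (n : ℕ) {g : α → E} (hg : Integrable g m) (hgr : Integrable (fun a => ‖g a‖ ^ r) m)
    (h : ∀ B, MeasurableSet[countableFiltration α n] B → ∫ a in B, g a ∂m = ν B) :
    ∫ a, ‖partitionDensity m ν n a‖ ^ r ∂m ≤ ∫ a, ‖g a‖ ^ r ∂m := by
  have hle := (countableFiltration α).le n
  have hce : partitionDensity m ν n =ᵐ[m] m[g | countableFiltration α n] :=
    ae_eq_condExp_of_forall_setIntegral_eq hle hg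
      (fun _ _ _ => (integrable_partitionDensity hν n).integrableOn)
      (fun B hB _ => (setIntegral_partitionDensity hν n hB).trans (h B hB).symm)
      (stronglyMeasurable_partitionDensity m ν n).aestronglyMeasurable
  have hcont : Continuous fun x : E => ‖x‖ ^ r :=
    continuous_norm.rpow_const fun _ => Or.inr (by linarith)
  have hJ := (convexOn_norm_rpow hr).map_condExp_le_univ hle hcont.lowerSemicontinuous hg hgr
  calc ∫ a, ‖partitionDensity m ν n a‖ ^ r ∂m
      ≤ ∫ a, (m[fun a => ‖g a‖ ^ r | countableFiltration α n]) a ∂m := by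
        refine integral_mono_of_nonneg (Eventually.of_forall fun a => by positivity)
          integrable_condExp ?_
        filter_upwards [hce, hJ] with a h1 h2
        rw [h1]
        exact h2
    _ = _ := integral_condExp hle

/-- A quantitative uniform convexity of the function `‖·‖ ^ r` on the unit ball. -/
def UniformlyConvexPower (E : Type*) [NormedAddCommGroup E] [NormedSpace ℝ E] (r : ℝ) : Prop :=
  ∀ δ > (0 : ℝ), ∃ C ≥ (0 : ℝ), ∀ x y : E, ‖x‖ ≤ 1 → ‖y‖ ≤ 1 →
    ‖x - y‖ ≤ δ + C * ((‖x‖ ^ r + ‖y‖ ^ r) / 2 - ‖(1 / 2 : ℝ) • (x + y)‖ ^ r)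

/-- The energies `e n` increase and are bounded. For `n ≤ k` the midpoint of the two averages still
integrates to `ν` over the cells of level `n`, so its energy is at least `e n`; the convexity gap is
then at most `(e k - e n) / 2`, and uniform convexity turns this into an `L¹` bound. -/
theorem cauchySeq_toL1_partitionDensity {r : ℝ} (hr : 1 ≤ r) (hE : UniformlyConvexPower E r)
    (hν : ∀ B, ‖ν B‖ ≤ m.real B) :
    CauchySeq fun n => (integrable_partitionDensity hν n).toL1 (partitionDensity m ν n) := by
  have hsm : ∀ n, StronglyMeasurable (partitionDensity m ν n) := fun n =>
    (stronglyMeasurable_partitionDensity m ν n).mono ((countableFiltration α).le n)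
  have hnr : ∀ n, Integrable (fun a => ‖partitionDensity m ν n a‖ ^ r) m := fun n =>
    integrable_norm_rpow_of_norm_le_one (hsm n) (norm_partitionDensity_le hν n) hr
  set e : ℕ → ℝ := fun n => ∫ a, ‖partitionDensity m ν n a‖ ^ r ∂m with he
  have hsub : ∀ {n k : ℕ}, n ≤ k → ∀ B, MeasurableSet[countableFiltration α n] B →
      ∫ a in B, partitionDensity m ν k a ∂m = ν B := fun hnk B hB =>
    setIntegral_partitionDensity hν _ ((countableFiltration α).mono hnk _ hB)
  have hmono : Monotone e := fun n k hnk =>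
    integral_norm_rpow_partitionDensity_le hν hr n (integrable_partitionDensity hν k) (hnr k)
      (hsub hnk)
  have hbdd : BddAbove (range e) := by
    refine ⟨m.real univ, ?_⟩
    rintro _ ⟨n, rfl⟩
    calc e n ≤ ∫ _, (1 : ℝ) ∂m := integral_mono (hnr n) (integrable_const _) fun a =>
          Real.rpow_le_one (norm_nonneg _) (norm_partitionDensity_le hν n a) (by linarith)
      _ = m.real univ := by simp
  have hcau := (tendsto_atTop_ciSup hmono hbdd).cauchySeq
  have key : ∀ δ > (0 : ℝ), ∃ C ≥ (0 : ℝ), ∀ n k, n ≤ k →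
      ∫ a, ‖partitionDensity m ν n a - partitionDensity m ν k a‖ ∂m
        ≤ δ * m.real univ + C * ((e k - e n) / 2) := by
    intro δ hδ
    obtain ⟨C, hC, hCle⟩ := hE δ hδ
    refine ⟨C, hC, fun n k hnk => ?_⟩
    set g : α → E := fun a =>
      (1 / 2 : ℝ) • (partitionDensity m ν n a + partitionDensity m ν k a) with hg
    have hgm : StronglyMeasurable g := ((hsm n).add (hsm k)).const_smul _
    have hgb : ∀ a, ‖g a‖ ≤ 1 := fun a => by
      have h1 := norm_partitionDensity_le hν n a
      have h2 := norm_partitionDensity_le hν k a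
      rw [hg, norm_smul, Real.norm_of_nonneg (by norm_num)]
      linarith [norm_add_le (partitionDensity m ν n a) (partitionDensity m ν k a)]
    have hgr : Integrable (fun a => ‖g a‖ ^ r) m :=
      integrable_norm_rpow_of_norm_le_one hgm hgb hr
    have hgi : Integrable g m := integrable_of_stronglyMeasurable_of_norm_le_one hgm hgb
    have hen : e n ≤ ∫ a, ‖g a‖ ^ r ∂m := by
      refine integral_norm_rpow_partitionDensity_le hν hr n hgi hgr fun B hB => ?_
      rw [hg, integral_smul, integral_add (integrable_partitionDensity hν n).integrableOn
        (integrable_partitionDensity hν k).integrableOn, hsub le_rfl B hB, hsub hnk B hB,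
        ← two_smul ℝ, smul_smul]
      norm_num
    have hint₁ : Integrable (fun a => ‖partitionDensity m ν n a‖ ^ r
        + ‖partitionDensity m ν k a‖ ^ r) m := (hnr n).add (hnr k)
    have hint₂ : Integrable (fun a => (‖partitionDensity m ν n a‖ ^ r
        + ‖partitionDensity m ν k a‖ ^ r) / 2 - ‖g a‖ ^ r) m := (hint₁.div_const 2).sub hgr
    have hint : Integrable (fun a => δ + C * ((‖partitionDensity m ν n a‖ ^ r
        + ‖partitionDensity m ν k a‖ ^ r) / 2 - ‖g a‖ ^ r)) m :=
      (integrable_const δ).add (hint₂.const_mul C)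
    calc ∫ a, ‖partitionDensity m ν n a - partitionDensity m ν k a‖ ∂m
        ≤ ∫ a, (δ + C * ((‖partitionDensity m ν n a‖ ^ r
        + ‖partitionDensity m ν k a‖ ^ r) / 2 - ‖g a‖ ^ r)) ∂m :=
          integral_mono ((integrable_partitionDensity hν n).sub
            (integrable_partitionDensity hν k)).norm hint fun a =>
            hCle _ _ (norm_partitionDensity_le hν n a) (norm_partitionDensity_le hν k a)
      _ = δ * m.real univ + C * ((e n + e k) / 2 - ∫ a, ‖g a‖ ^ r ∂m) := by
          rw [integral_add (integrable_const δ) (hint₂.const_mul C), integral_const_mul,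
            integral_sub (hint₁.div_const 2) hgr, integral_div,
            integral_add (hnr n) (hnr k)]
          simp [mul_comm, he]
      _ ≤ _ := by gcongr; linarith
  rw [Metric.cauchySeq_iff']
  intro ε hε
  have hM : 0 < m.real univ + 1 := by linarith [measureReal_nonneg (μ := m) (s := univ)]
  obtain ⟨C, hC, hCle⟩ := key (ε / 2 / (m.real univ + 1)) (by positivity)
  obtain ⟨N, hN⟩ := Metric.cauchySeq_iff'.1 hcau (ε / (C + 1)) (by positivity)
  refine ⟨N, fun k hk => ?_⟩
  have h1 := hCle N k hk
  have h2 : e k - e N < ε / (C + 1) := by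
    have := hN k hk
    rw [Real.dist_eq] at this
    exact (le_abs_self _).trans_lt this
  have h3 : ε / 2 / (m.real univ + 1) * m.real univ ≤ ε / 2 := by
    rw [div_mul_eq_mul_div, div_le_iff₀ hM]
    nlinarith [measureReal_nonneg (μ := m) (s := univ)]
  have h4 : C * ((e k - e N) / 2) < ε / 2 := by
    have h5 : C * ((e k - e N)) ≤ C * (ε / (C + 1)) := by gcongr
    have h6 : C * (ε / (C + 1)) < ε := by
      rw [mul_div_assoc', div_lt_iff₀ (by positivity)]
      nlinarith
    linarith
  rw [dist_comm, dist_eq_norm, ← Integrable.toL1_sub, L1.norm_of_fun_eq_integral_norm]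
  exact h1.trans_lt (by linarith)

/-- The Radon-Nikodym theorem for vector measures dominated by a finite measure, with values in a
space with a uniformly convex power of the norm. -/
theorem exists_density {r : ℝ} (hr : 1 ≤ r) (hE : UniformlyConvexPower E r)
    (hν : ∀ B, ‖ν B‖ ≤ m.real B) [PartialOrder E] [IsOrderedAddMonoid E] [IsOrderedModule ℝ E]
    [ClosedIciTopology E] (hpos : ∀ B, MeasurableSet B → 0 ≤ ν B) :
    ∃ ρ : α → E, StronglyMeasurable ρ ∧ Integrable ρ m ∧ (∀ᵐ a ∂m, 0 ≤ ρ a) ∧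
      ∀ B, MeasurableSet B → ∫ a in B, ρ a ∂m = ν B := by
  obtain ⟨L, hL⟩ := cauchySeq_tendsto_of_complete (cauchySeq_toL1_partitionDensity hr hE hν)
  have hnonneg : 0 ≤ L := by
    refine ge_of_tendsto' hL fun n => ?_
    rw [← Lp.coeFn_nonneg]
    filter_upwards [(integrable_partitionDensity hν n).coeFn_toL1] with a ha
    rw [ha]
    exact smul_nonneg (inv_nonneg.2 measureReal_nonneg)
      (hpos _ (measurableSet_countablePartitionSet n a))
  have hLi : Integrable L m := L1.integrable_coeFn L
  refine ⟨L, Lp.stronglyMeasurable L, hLi, (Lp.coeFn_nonneg L).2 hnonneg, ?_⟩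
  -- For `B` of level `n`, the integrals over `B` are constant from index `n` on, so the limit
  -- inherits their value.
  have hset : ∀ n B, MeasurableSet[countableFiltration α n] B → ∫ a in B, L a ∂m = ν B := by
    intro n B hB
    refine tendsto_nhds_unique (((continuous_setIntegral B).tendsto L).comp hL) ?_
    refine tendsto_const_nhds.congr' ?_
    filter_upwards [eventually_ge_atTop n] with k hk
    rw [← setIntegral_partitionDensity hν k ((countableFiltration α).mono hk _ hB)]
    exact setIntegral_congr_ae ((countableFiltration α).le n _ hB)
      ((integrable_partitionDensity hν k).coeFn_toL1.mono fun a ha _ => ha.symm)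
  have hext : m.withDensityᵥ L = ν := by
    refine VectorMeasure.ext_of_generateFrom
      (⋃ n, {t | MeasurableSet[countableFiltration α n] t}) ?_ ?_ ?_ ?_
    · intro B hB
      obtain ⟨n, hn⟩ := mem_iUnion.1 hB
      rw [withDensityᵥ_apply hLi ((countableFiltration α).le n _ hn), hset n B hn]
    · exact ((generateFrom_iUnion_measurableSet fun n => countableFiltration α n).trans
        (iSup_countableFiltration α)).symm
    · intro s hs t ht _
      obtain ⟨n, hn⟩ := mem_iUnion.1 hs
      obtain ⟨k, hk⟩ := mem_iUnion.1 ht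
      exact mem_iUnion.2 ⟨max n k, MeasurableSet.inter
        ((countableFiltration α).mono (le_max_left n k) _ hn)
        ((countableFiltration α).mono (le_max_right n k) _ hk)⟩
    · rw [withDensityᵥ_apply hLi MeasurableSet.univ, hset 0 univ MeasurableSet.univ]
  intro B hB
  rw [← withDensityᵥ_apply hLi hB, hext]

end VectorDensity

/-! ### Uniform convexity of the `L^p` norm for `1 < p < ∞`. -/

section LpConvexity

theorem half_add_rpow_lt {p : ℝ} (hp : 1 < p) {a b : ℝ} (hab : a ≠ b) :
    |(a + b) / 2| ^ p < (|a| ^ p + |b| ^ p) / 2 := by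
  have hp0 : 0 < p := by linarith
  rcases eq_or_ne |a| |b| with h | h
  · have hab' : a = -b := (abs_eq_abs.1 h).resolve_left hab
    have hb : b ≠ 0 := by
      rintro rfl
      exact hab (by simpa using hab')
    have : 0 < |b| ^ p := Real.rpow_pos_of_pos (abs_pos.2 hb) p
    rw [h, hab']
    simp [Real.zero_rpow hp0.ne', this]
  · have h1 := (strictConvexOn_rpow hp).2 (abs_nonneg a) (abs_nonneg b) h
      (show (0 : ℝ) < 1 / 2 by norm_num) (show (0 : ℝ) < 1 / 2 by norm_num) (by norm_num)
    simp only [smul_eq_mul] at h1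
    have h2 : |(a + b) / 2| ≤ 1 / 2 * |a| + 1 / 2 * |b| := by
      rw [abs_div, abs_two]
      linarith [abs_add_le a b]
    have h3 := Real.rpow_le_rpow (abs_nonneg _) h2 hp0.le
    linarith

theorem half_add_rpow_le {p : ℝ} (hp : 1 < p) (a b : ℝ) :
    |(a + b) / 2| ^ p ≤ (|a| ^ p + |b| ^ p) / 2 := by
  rcases eq_or_ne a b with rfl | h
  · simp
  · exact (half_add_rpow_lt hp h).le

/-- By homogeneity it suffices to treat the unit sphere of the plane. Where the `ε` term alone does
not suffice, the points form a compact set off the diagonal, on which the convexity gap has a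
positive minimum. -/
theorem exists_abs_sub_rpow_le {p : ℝ} (hp : 1 < p) {ε : ℝ} (hε : 0 < ε) :
    ∃ C ≥ (0 : ℝ), ∀ a b : ℝ, |a - b| ^ p ≤
      ε * (|a| ^ p + |b| ^ p) + C * ((|a| ^ p + |b| ^ p) / 2 - |(a + b) / 2| ^ p) := by
  have hp0 : 0 < p := by linarith
  suffices h : ∃ C ≥ (0 : ℝ), ∀ z ∈ Metric.sphere (0 : ℝ × ℝ) 1, |z.1 - z.2| ^ p ≤
      ε * (|z.1| ^ p + |z.2| ^ p) +
        C * ((|z.1| ^ p + |z.2| ^ p) / 2 - |(z.1 + z.2) / 2| ^ p) by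
    obtain ⟨C, hC, h⟩ := h
    refine ⟨C, hC, fun a b => ?_⟩
    rcases eq_or_ne ((a, b) : ℝ × ℝ) 0 with h0 | h0
    · obtain ⟨rfl, rfl⟩ := Prod.mk_eq_zero.1 h0
      simp [Real.zero_rpow hp0.ne']
    · set t := ‖((a, b) : ℝ × ℝ)‖ with ht
      have htpos : 0 < t := norm_pos_iff.2 h0
      have h1 := h (t⁻¹ • (a, b)) (by
        rw [mem_sphere_zero_iff_norm, norm_smul, norm_inv, Real.norm_of_nonneg htpos.le, ← ht,
          inv_mul_cancel₀ htpos.ne'])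
      simp only [Prod.smul_mk, smul_eq_mul] at h1
      have hs : ∀ x : ℝ, |t⁻¹ * x| ^ p = (t ^ p)⁻¹ * |x| ^ p := fun x => by
        rw [abs_mul, Real.mul_rpow (abs_nonneg _) (abs_nonneg _), abs_of_pos (inv_pos.2 htpos),
          Real.inv_rpow htpos.le]
      rw [← mul_sub, ← mul_add, mul_div_assoc, hs, hs, hs, hs] at h1
      have h2 := mul_le_mul_of_nonneg_left h1 (Real.rpow_nonneg htpos.le p)
      have h3 : t ^ p ≠ 0 := (Real.rpow_pos_of_pos htpos p).ne'
      field_simp at h2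
      field_simp
      linarith
  have hc1 : Continuous fun z : ℝ × ℝ => |z.1 - z.2| ^ p :=
    (by fun_prop : Continuous fun z : ℝ × ℝ => |z.1 - z.2|).rpow_const fun _ => Or.inr hp0.le
  have hc2 : Continuous fun z : ℝ × ℝ => |z.1| ^ p + |z.2| ^ p :=
    ((by fun_prop : Continuous fun z : ℝ × ℝ => |z.1|).rpow_const fun _ => Or.inr hp0.le).add
      ((by fun_prop : Continuous fun z : ℝ × ℝ => |z.2|).rpow_const fun _ => Or.inr hp0.le)
  have hc3 : Continuous fun z : ℝ × ℝ => |(z.1 + z.2) / 2| ^ p :=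
    (by fun_prop : Continuous fun z : ℝ × ℝ => |(z.1 + z.2) / 2|).rpow_const
      fun _ => Or.inr hp0.le
  set K : Set (ℝ × ℝ) := Metric.sphere 0 1 ∩
    {z | ε * (|z.1| ^ p + |z.2| ^ p) ≤ |z.1 - z.2| ^ p} with hK
  have hKc : IsCompact K :=
    (isCompact_sphere _ _).inter_right (isClosed_le (hc2.const_mul ε) hc1)
  rcases K.eq_empty_or_nonempty with hKe | hKn
  · refine ⟨0, le_rfl, fun z hz => ?_⟩
    by_contra! hcon
    have : z ∈ K := ⟨hz, by simpa using hcon.le⟩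
    rw [hKe] at this
    exact this
  · obtain ⟨w, hw, hmin⟩ := hKc.exists_isMinOn hKn ((hc2.div_const 2).sub hc3).continuousOn
    set g := (|w.1| ^ p + |w.2| ^ p) / 2 - |(w.1 + w.2) / 2| ^ p with hg
    have hgpos : 0 < g := by
      have hne : w.1 ≠ w.2 := by
        intro h
        have h1 : ε * (|w.1| ^ p + |w.2| ^ p) ≤ |w.1 - w.2| ^ p := hw.2
        rw [h, sub_self, abs_zero, Real.zero_rpow hp0.ne'] at h1
        have h2 : |w.2| ^ p = 0 := by
          have := Real.rpow_nonneg (abs_nonneg w.2) p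
          nlinarith
        have h3 : w.2 = 0 := by
          simpa [Real.rpow_eq_zero (abs_nonneg w.2) hp0.ne'] using h2
        have h4 : w = 0 := Prod.ext (h.trans h3) h3
        have h5 := hw.1
        rw [h4] at h5
        simp at h5
      exact sub_pos.2 (half_add_rpow_lt hp hne)
    -- On the sup-norm unit sphere `|z.1 - z.2| ≤ 2`, and on `K` the gap is at least `g`.
    refine ⟨2 ^ p / g, by positivity, fun z hz => ?_⟩
    by_cases hzK : z ∈ K
    · have h1 : g ≤ (|z.1| ^ p + |z.2| ^ p) / 2 - |(z.1 + z.2) / 2| ^ p := hmin hzK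
      have h2 : |z.1 - z.2| ≤ 2 := by
        have hz1 : ‖z‖ = 1 := by simpa using hz
        have ha := norm_fst_le z
        have hb := norm_snd_le z
        rw [hz1, Real.norm_eq_abs] at ha hb
        linarith [abs_sub z.1 z.2]
      calc |z.1 - z.2| ^ p ≤ 2 ^ p := Real.rpow_le_rpow (abs_nonneg _) h2 hp0.le
        _ = 2 ^ p / g * g := by field_simp
        _ ≤ 2 ^ p / g * ((|z.1| ^ p + |z.2| ^ p) / 2 - |(z.1 + z.2) / 2| ^ p) := by gcongr
        _ ≤ _ := le_add_of_nonneg_left (by positivity)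
    · have h1 : |z.1 - z.2| ^ p < ε * (|z.1| ^ p + |z.2| ^ p) := by
        by_contra! hcon
        exact hzK ⟨hz, hcon⟩
      have h2 := half_add_rpow_le hp z.1 z.2
      exact h1.le.trans (le_add_of_nonneg_right (mul_nonneg (by positivity) (by linarith)))

variable {D : Type*} [MeasurableSpace D] {μ : Measure D} {p : ℝ≥0∞} [Fact (1 ≤ p)]

theorem Lp_norm_rpow_eq_integral (hp_top : p ≠ ∞) (x : Lp ℝ p μ) :
    ‖x‖ ^ p.toReal = ∫ d, |x d| ^ p.toReal ∂μ := by
  have hp0 : p ≠ 0 := (zero_lt_one.trans_le (Fact.out : 1 ≤ p)).ne'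
  have hpr : 0 < p.toReal := ENNReal.toReal_pos hp0 hp_top
  have hnn : 0 ≤ ∫ d, ‖x d‖ ^ p.toReal ∂μ := integral_nonneg fun d => by positivity
  rw [Lp.norm_def, (Lp.memLp x).eLpNorm_eq_integral_rpow_norm hp0 hp_top,
    ENNReal.toReal_ofReal (Real.rpow_nonneg hnn _), ← Real.rpow_mul hnn,
    inv_mul_cancel₀ hpr.ne', Real.rpow_one]
  rfl

theorem uniformlyConvexPower_Lp (hp_one : 1 < p) (hp_top : p ≠ ∞) :
    UniformlyConvexPower (Lp ℝ p μ) p.toReal := by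
  have hp0 : p ≠ 0 := (zero_lt_one.trans hp_one).ne'
  set r := p.toReal with hr
  have hr1 : 1 < r := by
    rw [hr, ← ENNReal.toReal_one]
    exact (ENNReal.toReal_lt_toReal ENNReal.one_ne_top hp_top).2 hp_one
  have hint : ∀ x : Lp ℝ p μ, Integrable (fun d => |x d| ^ r) μ := fun x =>
    (Lp.memLp x).integrable_norm_rpow hp0 hp_top
  intro δ hδ
  have hδr : 0 < δ ^ r := Real.rpow_pos_of_pos hδ r
  -- On the unit ball the `ε` term is then at most `δ ^ r * δ / 2`. When `‖x - y‖ > δ`, multiplying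
  -- the integrated inequality by `2 / δ ^ r` turns this into `δ`, and the left side into at least
  -- `2 ≥ ‖x - y‖`.
  obtain ⟨C, hC, hCle⟩ := exists_abs_sub_rpow_le hr1 (show 0 < δ ^ r * δ / 4 by positivity)
  refine ⟨2 / δ ^ r * C, by positivity, fun x y hx hy => ?_⟩
  have hgap : 0 ≤ (‖x‖ ^ r + ‖y‖ ^ r) / 2 - ‖(1 / 2 : ℝ) • (x + y)‖ ^ r := by
    have := (convexOn_norm_rpow hr1.le).2 (mem_univ x) (mem_univ y)
      (show (0 : ℝ) ≤ 1 / 2 by norm_num) (show (0 : ℝ) ≤ 1 / 2 by norm_num) (by norm_num)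
    rw [← smul_add] at this
    simp only [smul_eq_mul] at this
    linarith
  have hkey : ‖x - y‖ ^ r ≤ δ ^ r * δ / 4 * (‖x‖ ^ r + ‖y‖ ^ r) +
      C * ((‖x‖ ^ r + ‖y‖ ^ r) / 2 - ‖(1 / 2 : ℝ) • (x + y)‖ ^ r) := by
    simp only [hr, Lp_norm_rpow_eq_integral hp_top]
    simp only [← hr]
    have h1 : Integrable (fun d => |x d| ^ r + |y d| ^ r) μ := (hint x).add (hint y)
    have h2 : Integrable (fun d => (|x d| ^ r + |y d| ^ r) / 2 -
        |((1 / 2 : ℝ) • (x + y)) d| ^ r) μ := (h1.div_const 2).sub (hint _)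
    rw [← integral_add (hint x) (hint y), ← integral_div, ← integral_sub (h1.div_const 2) (hint _),
      ← integral_const_mul, ← integral_const_mul, ← integral_add (h1.const_mul _) (h2.const_mul _)]
    refine integral_mono_ae (hint _) ((h1.const_mul _).add (h2.const_mul _)) ?_
    filter_upwards [Lp.coeFn_sub x y, Lp.coeFn_smul (1 / 2 : ℝ) (x + y), Lp.coeFn_add x y]
      with d h3 h4 h5
    have h6 : ((1 / 2 : ℝ) • (x + y)) d = (x d + y d) / 2 := by
      rw [h4, Pi.smul_apply, h5, Pi.add_apply, smul_eq_mul]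
      ring
    rw [h3, h6]
    exact hCle (x d) (y d)
  rcases le_or_gt ‖x - y‖ δ with hle | hlt
  · exact hle.trans (le_add_of_nonneg_right (by positivity))
  · have h1 : ‖x‖ ^ r ≤ 1 := Real.rpow_le_one (norm_nonneg _) hx (by linarith)
    have h2 : ‖y‖ ^ r ≤ 1 := Real.rpow_le_one (norm_nonneg _) hy (by linarith)
    have h3 : δ ^ r ≤ ‖x - y‖ ^ r := Real.rpow_le_rpow hδ.le hlt.le (by linarith)
    have h4 : ‖x - y‖ ≤ 2 := (norm_sub_le x y).trans (by linarith)
    have h5 : δ ^ r * δ / 4 * (‖x‖ ^ r + ‖y‖ ^ r) ≤ δ ^ r * δ / 4 * 2 := by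
      gcongr
      linarith
    calc ‖x - y‖ ≤ 2 := h4
      _ = 2 / δ ^ r * δ ^ r := by field_simp
      _ ≤ 2 / δ ^ r * (δ ^ r * δ / 4 * 2 +
          C * ((‖x‖ ^ r + ‖y‖ ^ r) / 2 - ‖(1 / 2 : ℝ) • (x + y)‖ ^ r)) := by
        gcongr
        linarith
      _ = _ := by field_simp; ring

end LpConvexity

/-! ### The time interval and its exhaustion by compact intervals. -/

section TimeInterval

variable {T : ℝ≥0∞}

theorem Time.zero_le (t : Time T) : Time.zero T ≤ t := Subtype.coe_le_coe.1 _root_.zero_le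

theorem Time.Icc_zero (t : Time T) : Icc (Time.zero T) t = Iic t := by
  ext s
  simp [Time.zero_le]

theorem Time.Iic_zero : Iic (Time.zero T) = {Time.zero T} := by
  ext s
  simp only [mem_Iic, mem_singleton_iff]
  exact ⟨fun h => le_antisymm h s.zero_le, fun h => h.le⟩

theorem Time.singleton_union_Ioc (t : Time T) :
    {Time.zero T} ∪ Ioc (Time.zero T) t = Iic t := by
  rw [← Time.Iic_zero, Iic_union_Ioc_eq_Iic t.zero_le]

theorem Time.disjoint_singleton_Ioc (t : Time T) :
    Disjoint {Time.zero T} (Ioc (Time.zero T) t) := by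
  simp

instance : Nonempty (Time T) := ⟨Time.zero T⟩

instance : CompactIccSpace (Time T) := by
  refine ⟨fun {a b} => ?_⟩
  rw [Subtype.isCompact_iff]
  have : ((↑) : Time T → ℝ≥0) '' Icc a b = Icc (a : ℝ≥0) b := by
    ext x
    constructor
    · rintro ⟨y, hy, rfl⟩
      exact ⟨hy.1, hy.2⟩
    · intro hx
      exact ⟨⟨x, (inferInstance : (horizon T).OrdConnected).out a.2 b.2 hx⟩, hx, rfl⟩
  rw [this]
  exact isCompact_Icc

theorem Time.exists_seq_exhausting (T : ℝ≥0∞) :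
    ∃ b : ℕ → Time T, Monotone b ∧ ∀ t, ∃ n, t ≤ b n := by
  obtain ⟨b, hb, hlim⟩ := exists_seq_monotone_tendsto_atTop_atTop (Time T)
  exact ⟨b, hb, fun t => (hlim.eventually_ge_atTop t).exists⟩

end TimeInterval

/-! ### Densities are determined by their primitives. -/

section Uniqueness

variable {T : ℝ≥0∞} {E : Type*} [NormedAddCommGroup E] [NormedSpace ℝ E] [CompleteSpace E]
  {m : Measure (Time T)} {ρ ρ' : Time T → E}

theorem ae_eq_restrict_Iic_of_forall_setIntegral_Iic_eq {b : Time T}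
    (h : IntegrableOn ρ (Iic b) m) (h' : IntegrableOn ρ' (Iic b) m)
    (heq : ∀ t ≤ b, ∫ s in Iic t, ρ s ∂m = ∫ s in Iic t, ρ' s ∂m) :
    ρ =ᵐ[m.restrict (Iic b)] ρ' := by
  refine Integrable.ae_eq_of_withDensityᵥ_eq h h' ?_
  refine VectorMeasure.ext_of_generateFrom (range Iic) ?_ ?_ isPiSystem_Iic ?_
  · rintro _ ⟨t, rfl⟩
    rw [withDensityᵥ_apply h measurableSet_Iic, withDensityᵥ_apply h' measurableSet_Iic,
      Measure.restrict_restrict measurableSet_Iic, Iic_inter_Iic]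
    exact heq _ inf_le_right
  · rw [← borel_eq_generateFrom_Iic]
    exact BorelSpace.measurable_eq
  · rw [withDensityᵥ_apply h MeasurableSet.univ, withDensityᵥ_apply h' MeasurableSet.univ,
      Measure.restrict_univ]
    exact heq b le_rfl

theorem ae_of_forall_ae_restrict_Iic {p : Time T → Prop}
    (h : ∀ b, ∀ᵐ s ∂m.restrict (Iic b), p s) : ∀ᵐ s ∂m, p s := by
  obtain ⟨b, -, hb⟩ := Time.exists_seq_exhausting T
  have hU : ⋃ n, Iic (b n) = (univ : Set (Time T)) := eq_univ_of_forall fun t =>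
    mem_iUnion.2 (hb t)
  rw [← Measure.restrict_univ (μ := m), ← hU, ae_restrict_iUnion_iff]
  exact fun n => h _

theorem ae_eq_of_forall_setIntegral_Iic_eq
    (h : ∀ t, IntegrableOn ρ (Iic t) m) (h' : ∀ t, IntegrableOn ρ' (Iic t) m)
    (heq : ∀ t, ∫ s in Iic t, ρ s ∂m = ∫ s in Iic t, ρ' s ∂m) : ρ =ᵐ[m] ρ' :=
  ae_of_forall_ae_restrict_Iic fun b =>
    ae_eq_restrict_Iic_of_forall_setIntegral_Iic_eq (h b) (h' b) fun t _ => heq t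

end Uniqueness

/-! ### Primitives of nonnegative densities are control paths. -/

section Primitive

variable {T : ℝ≥0∞} {E : Type*} [NormedAddCommGroup E] [NormedSpace ℝ E]
  {m : Measure (Time T)} {ρ : Time T → E}

theorem setIntegral_Iic_sub_setIntegral_Iic (h : ∀ t, IntegrableOn ρ (Iic t) m) {u v : Time T}
    (huv : u ≤ v) :
    ∫ s in Iic v, ρ s ∂m - ∫ s in Iic u, ρ s ∂m = ∫ s in Ioc u v, ρ s ∂m := by
  rw [← Iic_union_Ioc_eq_Iic huv, setIntegral_union (Iic_disjoint_Ioc le_rfl) measurableSet_Ioc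
    (h u) ((h v).mono_set Ioc_subset_Iic_self), add_sub_cancel_left]

theorem continuousWithinAt_setIntegral_Iic (h : ∀ t, IntegrableOn ρ (Iic t) m) (t : Time T) :
    ContinuousWithinAt (fun u => ∫ s in Iic u, ρ s ∂m) (Ici t) t := by
  -- Integrability is only local, so dominated convergence needs an endpoint `b` beyond `t`; at a
  -- final time right-continuity is void.
  by_cases htop : ∃ b, t < b
  · obtain ⟨b, hb⟩ := htop
    have hev : ∀ᶠ u in 𝓝[Ici t] t, u ≤ b :=
      mem_nhdsWithin_of_mem_nhds (Iic_mem_nhds hb)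
    have hlim : Tendsto (fun u => ∫ s in Iic b, (Iic u).indicator ρ s ∂m) (𝓝[Ici t] t)
        (𝓝 (∫ s in Iic b, (Iic t).indicator ρ s ∂m)) := by
      refine tendsto_integral_filter_of_dominated_convergence (fun s => ‖ρ s‖) ?_ ?_
        (h b).norm ?_
      · exact Eventually.of_forall fun u =>
          (h b).aestronglyMeasurable.indicator measurableSet_Iic
      · exact Eventually.of_forall fun u => Eventually.of_forall fun s =>
          norm_indicator_le_norm_self _ _
      · refine Eventually.of_forall fun s => ?_
        refine tendsto_const_nhds.congr' ?_
        rcases le_or_gt s t with hs | hs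
        · filter_upwards [self_mem_nhdsWithin] with u hu
          rw [indicator_of_mem (mem_Iic.2 hs), indicator_of_mem (mem_Iic.2 (hs.trans hu))]
        · filter_upwards [mem_nhdsWithin_of_mem_nhds (Iio_mem_nhds hs)] with u hu
          rw [indicator_of_notMem (by simpa using hs), indicator_of_notMem (by simpa using hu)]
    have hval : ∀ u ≤ b, ∫ s in Iic b, (Iic u).indicator ρ s ∂m = ∫ s in Iic u, ρ s ∂m := by
      intro u hu
      rw [setIntegral_indicator measurableSet_Iic, Iic_inter_Iic, inf_eq_right.2 hu]
    rw [hval t hb.le] at hlim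
    exact hlim.congr' (hev.mono hval)
  · have : Ici t = {t} := by
      ext u
      simp only [mem_Ici, mem_singleton_iff]
      push Not at htop
      exact ⟨fun hu => le_antisymm (htop u) hu, fun hu => hu.ge⟩
    rw [this]
    exact continuousWithinAt_singleton

theorem locallyBoundedVariationOn_of_edist_le {F : Type*} [PseudoEMetricSpace F]
    {g : Time T → F} {G : Time T → ℝ} (hG : Monotone G)
    (h : ∀ u v, u ≤ v → edist (g v) (g u) ≤ edist (G v) (G u)) :
    LocallyBoundedVariationOn g univ := by
  intro a b ha hb
  refine ne_top_of_le_ne_top ((hG.monotoneOn univ).locallyBoundedVariationOn a b ha hb) ?_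
  refine iSup_le fun p => ?_
  refine le_trans (Finset.sum_le_sum fun i _ => h _ _ (p.2.2.1 (Nat.le_succ i))) ?_
  exact eVariationOn.sum_le p.2.2.1 p.2.2.2

variable [PartialOrder E] [IsOrderedAddMonoid E] [IsOrderedModule ℝ E] [ClosedIciTopology E]

theorem isControlPath_setIntegral_Iic (h : ∀ t, IntegrableOn ρ (Iic t) m) (hρ : ∀ t, 0 ≤ ρ t) :
    IsControlPath fun t => ∫ s in Iic t, ρ s ∂m where
  nonneg _ := integral_nonneg hρ
  mono u v huv := by
    rw [← sub_nonneg, setIntegral_Iic_sub_setIntegral_Iic h huv]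
    exact integral_nonneg hρ
  right_continuous := continuousWithinAt_setIntegral_Iic h
  finite_variation := by
    have hn : ∀ t, IntegrableOn (fun s => ‖ρ s‖) (Iic t) m := fun t => (h t).norm
    refine locallyBoundedVariationOn_of_edist_le (G := fun t => ∫ s in Iic t, ‖ρ s‖ ∂m) ?_ ?_
    · intro u v huv
      exact setIntegral_mono_set (hn v) (Eventually.of_forall fun _ => norm_nonneg _)
        (Iic_subset_Iic.2 huv).eventuallyLE
    · intro u v huv
      rw [edist_dist, edist_dist, dist_eq_norm, dist_eq_norm,
        setIntegral_Iic_sub_setIntegral_Iic h huv, setIntegral_Iic_sub_setIntegral_Iic hn huv]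
      exact ENNReal.ofReal_le_ofReal ((norm_integral_le_integral_norm _).trans (le_abs_self _))

/-- Converse to the existence of polar pairs: off the control paths, `polar` takes its default
value. -/
theorem IsPolar.isControlPath {f : Time T → E} (h : IsPolar f m ρ) : IsControlPath f := by
  have : f = fun t => ∫ s in Iic t, ρ s ∂m := funext fun t => (h.density t).symm
  rw [this]
  exact isControlPath_setIntegral_Iic h.integrable h.nonneg

end Primitive

/-! ### The variation measure as a Stieltjes measure with an atom at `0`. -/

section VariationMeasure

variable {T : ℝ≥0∞} {E : Type*} [NormedAddCommGroup E] {f : Time T → E}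

theorem eVariationOn_Iic_ne_top (hf : LocallyBoundedVariationOn f univ) (t : Time T) :
    eVariationOn f (Iic t) ≠ ∞ := by
  have := hf (Time.zero T) t (mem_univ _) (mem_univ _)
  rwa [univ_inter, Time.Icc_zero] at this

theorem eVariationOn_Iic_add (f : Time T → E) {u v : Time T} (huv : u ≤ v) :
    eVariationOn f (Iic u) + eVariationOn f (Icc u v) = eVariationOn f (Iic v) := by
  have := eVariationOn.Icc_add_Icc f (s := univ) u.zero_le huv (mem_univ _)
  simpa [Time.Icc_zero] using this

/-- The variation function of a right-continuous path of locally bounded variation. -/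
noncomputable def variationStieltjes (f : Time T → E)
    (hf : LocallyBoundedVariationOn f univ) (hr : ∀ t, ContinuousWithinAt f (Ici t) t) :
    StieltjesFunction (Time T) where
  toFun t := (eVariationOn f (Iic t)).toReal
  mono' u v huv := ENNReal.toReal_mono (eVariationOn_Iic_ne_top hf v)
    (eVariationOn.mono f (Iic_subset_Iic.2 huv))
  right_continuous' t := by
    have h1 : Tendsto (fun u => eVariationOn f (Icc t u)) (𝓝[Ici t] t) (𝓝 0) := by
      by_cases htop : ∃ b, t < b
      · obtain ⟨b, hb⟩ := htop
        have hbv : BoundedVariationOn f (Iic b) := eVariationOn_Iic_ne_top hf b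
        have h2 := hbv.tendsto_eVariationOn_Icc_zero_right t
          ((hr t).mono inter_subset_right)
        have hev : Iic b ∈ 𝓝 t := Iic_mem_nhds hb
        rw [nhdsWithin_eq_nhds.2 hev] at h2
        refine (h2.mono_left nhdsWithin_le_nhds).congr' ?_
        filter_upwards [mem_nhdsWithin_of_mem_nhds hev] with u hu
        rw [inter_eq_right.2 (Icc_subset_Iic_self.trans (Iic_subset_Iic.2 hu))]
      · push Not at htop
        refine tendsto_const_nhds.congr fun u => (eVariationOn.subsingleton f ?_).symm
        intro x hx y hy
        exact le_antisymm ((htop x).trans hy.1) ((htop y).trans hx.1)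
    have h3 : Tendsto (fun u => (eVariationOn f (Iic t)).toReal + (eVariationOn f (Icc t u)).toReal)
        (𝓝[Ici t] t) (𝓝 ((eVariationOn f (Iic t)).toReal + 0)) :=
      tendsto_const_nhds.add ((ENNReal.tendsto_toReal ENNReal.zero_ne_top).comp h1)
    rw [add_zero] at h3
    refine h3.congr' ?_
    filter_upwards [self_mem_nhdsWithin] with u hu
    have h4 := eVariationOn_Iic_add f hu
    rw [← h4, ENNReal.toReal_add (eVariationOn_Iic_ne_top hf t)]
    exact ne_top_of_le_ne_top (eVariationOn_Iic_ne_top hf u)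
      (eVariationOn.mono f Icc_subset_Iic_self)

variable (hf : LocallyBoundedVariationOn f univ) (hr : ∀ t, ContinuousWithinAt f (Ici t) t)

theorem variationStieltjes_measure_Ioc {u v : Time T} (huv : u ≤ v) :
    (variationStieltjes f hf hr).measure (Ioc u v) = eVariationOn f (Icc u v) := by
  have h1 := eVariationOn_Iic_add f huv
  have h2 : eVariationOn f (Icc u v) ≠ ∞ := ne_top_of_le_ne_top (eVariationOn_Iic_ne_top hf v)
      (eVariationOn.mono f Icc_subset_Iic_self)
  rw [StieltjesFunction.measure_Ioc]
  change ENNReal.ofReal ((eVariationOn f (Iic v)).toReal - (eVariationOn f (Iic u)).toReal) = _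
  rw [← h1, ENNReal.toReal_add (eVariationOn_Iic_ne_top hf u) h2, add_sub_cancel_left,
    ENNReal.ofReal_toReal h2]

/-- A Stieltjes measure sees no jump at the least point, so the initial mass `‖f 0‖` has to be added
as a Dirac mass. -/
theorem variationStieltjes_measure_zero :
    (variationStieltjes f hf hr).measure {Time.zero T} = 0 := by
  rw [← botSet_eq_singleton_of_isBot (fun t => Time.zero_le t)]
  exact StieltjesFunction.measure_botSet _

/-- The variation measure of a path, with mass `‖f 0‖` at time `0`. -/
noncomputable def pathMeasure (f : Time T → E) (hf : LocallyBoundedVariationOn f univ)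
    (hr : ∀ t, ContinuousWithinAt f (Ici t) t) : Measure (Time T) :=
  (variationStieltjes f hf hr).measure + ‖f (Time.zero T)‖ₑ • Measure.dirac (Time.zero T)

theorem pathMeasure_Iic (t : Time T) :
    pathMeasure f hf hr (Iic t) = ‖f (Time.zero T)‖ₑ + eVariationOn f (Iic t) := by
  rw [pathMeasure, Measure.add_apply, Measure.smul_apply,
    Measure.dirac_apply' _ measurableSet_Iic, indicator_of_mem (mem_Iic.2 t.zero_le),
    ← Time.singleton_union_Ioc t, measure_union (Time.disjoint_singleton_Ioc t) measurableSet_Ioc,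
    variationStieltjes_measure_zero, variationStieltjes_measure_Ioc hf hr t.zero_le,
    Time.singleton_union_Ioc, Time.Icc_zero, zero_add, add_comm]
  simp

theorem pathMeasure_restrict_Iic (b : Time T) :
    (pathMeasure f hf hr).restrict (Iic b) =
      (variationStieltjes f hf hr).measure.restrict (Ioc (Time.zero T) b) +
        ‖f (Time.zero T)‖ₑ • Measure.dirac (Time.zero T) := by
  classical
  rw [pathMeasure, Measure.restrict_add, Measure.restrict_smul,
    MeasureTheory.restrict_dirac' measurableSet_Iic, if_pos (mem_Iic.2 b.zero_le)]
  congr 1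
  rw [← Time.singleton_union_Ioc b, Measure.restrict_union (Time.disjoint_singleton_Ioc b)
    measurableSet_Ioc, Measure.restrict_eq_zero.2 (variationStieltjes_measure_zero hf hr), zero_add]

end VariationMeasure

/-! ### Existence of the polar decomposition of a control path. -/

section Existence

variable {T : ℝ≥0∞} {E : Type*} [NormedAddCommGroup E]

theorem enorm_sub_le_variationStieltjes_measure {f : Time T → E}
    (hf : LocallyBoundedVariationOn f univ) (hr : ∀ t, ContinuousWithinAt f (Ici t) t)
    {u v : Time T} (huv : u ≤ v) :
    ‖f v - f u‖ₑ ≤ (variationStieltjes f hf hr).measure (Ioc u v) := by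
  rw [variationStieltjes_measure_Ioc hf hr huv, ← edist_eq_enorm_sub]
  exact eVariationOn.edist_le f (right_mem_Icc.2 huv) (left_mem_Icc.2 huv)

theorem isFiniteMeasure_variationStieltjes_restrict {f : Time T → E}
    (hf : LocallyBoundedVariationOn f univ) (hr : ∀ t, ContinuousWithinAt f (Ici t) t)
    (b : Time T) :
    IsFiniteMeasure ((variationStieltjes f hf hr).measure.restrict (Ioc (Time.zero T) b)) := by
  refine ⟨?_⟩
  rw [Measure.restrict_apply_univ, variationStieltjes_measure_Ioc hf hr b.zero_le, Time.Icc_zero]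
  exact (eVariationOn_Iic_ne_top hf b).lt_top

theorem generateFrom_Ioc_time (T : ℝ≥0∞) : (inferInstance : MeasurableSpace (Time T)) =
    MeasurableSpace.generateFrom {s | ∃ u v : Time T, u ≤ v ∧ s = Ioc u v} := by
  have h := borel_eq_generateFrom_Ioc_le (Time T)
  rw [← BorelSpace.measurable_eq (α := Time T)] at h
  refine h.trans (congrArg _ ?_)
  ext s
  simp only [eq_comm]

/-- The vector measure `df` on `(0, b]`. -/
theorem exists_vectorMeasure_Ioc [CompleteSpace E] {f : Time T → E}
    (hf : LocallyBoundedVariationOn f univ) (hr : ∀ t, ContinuousWithinAt f (Ici t) t)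
    (b : Time T) :
    ∃ ν : VectorMeasure (Time T) E, (∀ u v, u ≤ v → ν (Ioc u v) = f (v ⊓ b) - f (u ⊓ b)) ∧
      ∀ B, ‖ν B‖ₑ ≤ (variationStieltjes f hf hr).measure.restrict (Ioc (Time.zero T) b) B := by
  have := isFiniteMeasure_variationStieltjes_restrict hf hr b
  -- Freezing the path at `b` gives an additive interval function dominated by a finite measure,
  -- hence extendable to a vector measure.
  have hle : ∀ s ∈ {s | ∃ u v : Time T, u ≤ v ∧ s = Ioc u v},
      ‖AddContent.onIoc (fun t => f (t ⊓ b)) s‖ₑ ≤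
        (variationStieltjes f hf hr).measure.restrict (Ioc (Time.zero T) b) s := by
    rintro _ ⟨u, v, huv, rfl⟩
    rw [AddContent.onIoc_apply huv, Measure.restrict_apply measurableSet_Ioc]
    refine (enorm_sub_le_variationStieltjes_measure hf hr
      (inf_le_inf_right b huv)).trans (measure_mono fun s hs => ?_)
    rcases le_total u b with hub | hub
    · rw [inf_eq_left.2 hub] at hs
      exact ⟨⟨hs.1, hs.2.trans inf_le_left⟩, ⟨u.zero_le.trans_lt hs.1, hs.2.trans inf_le_right⟩⟩
    · rw [inf_eq_right.2 hub] at hs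
      exact absurd (hs.1.trans_le (hs.2.trans inf_le_right)) (lt_irrefl _)
  obtain ⟨ν, hν, hνle⟩ :=
    VectorMeasure.exists_extension_of_isSetSemiring_of_le_measure_of_generateFrom
      IsSetSemiring.Ioc hle (generateFrom_Ioc_time T)
  refine ⟨ν, fun u v huv => ?_, hνle⟩
  rw [hν _ ⟨u, v, huv, rfl⟩, AddContent.onIoc_apply huv]

variable [PartialOrder E] [IsOrderedAddMonoid E] [ClosedIciTopology E]

/-- A vector measure that is dominated by a finite measure and nonnegative on half-open intervals
is nonnegative. -/
theorem vectorMeasure_nonneg_of_Ioc {m : Measure (Time T)} [IsFiniteMeasure m]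
    {ν : VectorMeasure (Time T) E} (hν : ∀ B, ‖ν B‖ₑ ≤ m B) {b : Time T}
    (hb : m (Ioc (Time.zero T) b)ᶜ = 0) (hpos : ∀ u v, u ≤ v → 0 ≤ ν (Ioc u v))
    {B : Set (Time T)} (hB : MeasurableSet B) : 0 ≤ ν B := by
  set C : Set (Set (Time T)) := {s | ∃ u v : Time T, u ≤ v ∧ s = Ioc u v} with hC
  have hsr : IsSetSemiring C := IsSetSemiring.Ioc
  have hCm : ∀ s ∈ C, MeasurableSet s := by
    rintro _ ⟨u, v, -, rfl⟩
    exact measurableSet_Ioc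
  have happ : ∀ ε > (0 : ℝ≥0∞), ∃ t, MeasurableSet t ∧ 0 ≤ ν t ∧ m (symmDiff t B) < ε := by
    intro ε hε
    obtain ⟨t, ht, htε⟩ := exists_measure_symmDiff_lt_of_generateFrom_isSetSemiring (μ := m) hsr
      ⟨{Ioc (Time.zero T) b}, countable_singleton _,
        singleton_subset_iff.2 ⟨_, _, b.zero_le, rfl⟩, by simpa using hb⟩
      (generateFrom_Ioc_time T) hB hε
    obtain ⟨Q, hQ⟩ := hsr.mem_supClosure_iff.1 ht
    have htU : t = ⋃ s ∈ Q.parts, s := by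
      have := Q.sup_parts
      rw [Finset.sup_id_eq_sSup, sSup_eq_sUnion, sUnion_eq_biUnion] at this
      exact this.symm
    have hm : ∀ s ∈ Q.parts, MeasurableSet s := fun s hs => hCm s (hQ hs)
    refine ⟨t, ?_, ?_, htε⟩
    · rw [htU]
      exact Finset.measurableSet_biUnion _ hm
    · rw [htU, VectorMeasure.of_biUnion_finset (f := fun s => s) (fun s hs s' hs' hne =>
        Q.disjoint hs hs' hne) hm]
      refine Finset.sum_nonneg fun s hs => ?_
      obtain ⟨u, v, huv, rfl⟩ := hQ hs
      exact hpos u v huv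
  -- Each term on the right is bounded by `m (symmDiff s t)`; hence the factor `2` below and
  -- convergence along approximating unions of intervals.
  have hdiff : ∀ s t, MeasurableSet s → MeasurableSet t → ν s - ν t = ν (s \ t) - ν (t \ s) := by
    intro s t hs ht
    have h1 := VectorMeasure.of_union (v := ν) (disjoint_sdiff_inter (s := s) (t := t))
      (hs.diff ht) (hs.inter ht)
    have h2 := VectorMeasure.of_union (v := ν) (disjoint_sdiff_inter (s := t) (t := s))
      (ht.diff hs) (ht.inter hs)
    rw [sdiff_union_inter] at h1 h2
    rw [h1, h2, inter_comm t s]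
    abel
  choose t htm htpos htε using fun n : ℕ => happ ((n : ℝ≥0∞) + 1)⁻¹ (by simp)
  have hlim : Tendsto (fun n => ν (t n)) atTop (𝓝 (ν B)) := by
    rw [tendsto_iff_edist_tendsto_0]
    have h0 : Tendsto (fun n : ℕ => 2 * ((n : ℝ≥0∞) + 1)⁻¹) atTop (𝓝 0) := by
      have h1 : Tendsto (fun n : ℕ => ((n : ℝ≥0∞) + 1)⁻¹) atTop (𝓝 0) := by
        have := (tendsto_add_atTop_iff_nat 1).2 ENNReal.tendsto_inv_nat_nhds_zero
        simpa using this
      simpa using ENNReal.Tendsto.const_mul h1 (Or.inr (by simp))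
    refine tendsto_of_tendsto_of_tendsto_of_le_of_le tendsto_const_nhds h0
      (fun _ => zero_le) fun n => ?_
    change edist (ν (t n)) (ν B) ≤ _
    rw [edist_eq_enorm_sub, hdiff _ _ (htm n) hB, two_mul]
    refine (enorm_sub_le).trans (add_le_add ?_ ?_)
    · exact (hν _).trans ((measure_mono (le_sup_left : t n \ B ≤ _)).trans (htε n).le)
    · exact (hν _).trans ((measure_mono (le_sup_right : B \ t n ≤ _)).trans (htε n).le)
  exact ge_of_tendsto' hlim htpos

variable [NormedSpace ℝ E] [IsOrderedModule ℝ E] [CompleteSpace E]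

theorem exists_density_Iic {r : ℝ} (hr1 : 1 ≤ r) (hE : UniformlyConvexPower E r)
    {f : Time T → E} (h : IsControlPath f) (b : Time T) :
    ∃ ρ : Time T → E, StronglyMeasurable ρ ∧
      IntegrableOn ρ (Iic b) (pathMeasure f h.finite_variation h.right_continuous) ∧
      (∀ᵐ s ∂(pathMeasure f h.finite_variation h.right_continuous).restrict (Iic b), 0 ≤ ρ s) ∧
      ∀ t ≤ b, ∫ s in Iic t, ρ s ∂(pathMeasure f h.finite_variation h.right_continuous) = f t := by
  set hf := h.finite_variation
  set hr := h.right_continuous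
  have hfin := isFiniteMeasure_variationStieltjes_restrict hf hr b
  obtain ⟨ν₀, hν₀, hle⟩ := exists_vectorMeasure_Ioc hf hr b
  set ν : VectorMeasure (Time T) E := ν₀ + VectorMeasure.dirac (Time.zero T) (f (Time.zero T))
    with hνdef
  have hmres := pathMeasure_restrict_Iic hf hr b
  have hmfin : IsFiniteMeasure ((pathMeasure f hf hr).restrict (Iic b)) := by
    refine ⟨?_⟩
    rw [Measure.restrict_apply_univ, pathMeasure_Iic]
    exact ENNReal.add_lt_top.2 ⟨enorm_lt_top, (eVariationOn_Iic_ne_top hf b).lt_top⟩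
  have hν : ∀ B, ‖ν B‖ ≤ ((pathMeasure f hf hr).restrict (Iic b)).real B := by
    intro B
    rw [← toReal_enorm, measureReal_def]
    refine ENNReal.toReal_mono (measure_ne_top _ _) ?_
    rw [hmres, Measure.add_apply, hνdef, _root_.add_apply]
    refine (enorm_add_le _ _).trans (add_le_add (hle B) ?_)
    -- The bound covers nonmeasurable `B` as well, since vector measures vanish there.
    by_cases hB : MeasurableSet B ∧ Time.zero T ∈ B
    · rw [VectorMeasure.dirac_apply_of_mem hB.1 hB.2, Measure.smul_apply,
        Measure.dirac_apply_of_mem hB.2, smul_eq_mul, mul_one]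
    · have : VectorMeasure.dirac (Time.zero T) (f (Time.zero T)) B = 0 := by
        by_cases hB' : MeasurableSet B
        · exact VectorMeasure.dirac_apply_of_notMem fun h0 => hB ⟨hB', h0⟩
        · exact VectorMeasure.not_measurable _ hB'
      simp [this]
  have hpos : ∀ B, MeasurableSet B → 0 ≤ ν B := by
    intro B hB
    have h1 : 0 ≤ ν₀ B := by
      refine vectorMeasure_nonneg_of_Ioc hle (b := b) ?_ (fun u v huv => ?_) hB
      · rw [Measure.restrict_apply measurableSet_Ioc.compl, compl_inter_self, measure_empty]
      · rw [hν₀ u v huv, sub_nonneg]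
        exact h.mono (inf_le_inf_right b huv)
    rw [hνdef, _root_.add_apply]
    refine add_nonneg h1 ?_
    by_cases h0 : Time.zero T ∈ B
    · rw [VectorMeasure.dirac_apply_of_mem hB h0]
      exact h.nonneg _
    · rw [VectorMeasure.dirac_apply_of_notMem h0]
  obtain ⟨ρ, hρm, hρi, hρ0, hρ⟩ := exists_density hr1 hE hν hpos
  refine ⟨ρ, hρm, hρi, hρ0, fun t ht => ?_⟩
  have h1 := hρ (Iic t) measurableSet_Iic
  rw [Measure.restrict_restrict measurableSet_Iic, Iic_inter_Iic, inf_eq_left.2 ht] at h1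
  rw [h1, hνdef, _root_.add_apply,
    VectorMeasure.dirac_apply_of_mem measurableSet_Iic (mem_Iic.2 t.zero_le),
    ← Time.singleton_union_Ioc t, VectorMeasure.of_union (Time.disjoint_singleton_Ioc t)
      (measurableSet_singleton _) measurableSet_Ioc, hν₀ _ _ t.zero_le, inf_eq_left.2 ht,
    inf_eq_left.2 b.zero_le]
  have h2 : ν₀ {Time.zero T} = 0 := by
    have h3 := hle {Time.zero T}
    rw [Measure.restrict_apply (measurableSet_singleton _),
      (Time.disjoint_singleton_Ioc b).inter_eq, measure_empty] at h3
    exact enorm_eq_zero.1 (le_antisymm h3 zero_le)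
  rw [h2]
  abel

/-- Every control path `f` has a representation `df = ρ d|f|`. -/
theorem IsControlPath.exists_isPolar {r : ℝ} (hr1 : 1 ≤ r) (hE : UniformlyConvexPower E r)
    {f : Time T → E} (h : IsControlPath f) :
    ∃ mρ : Measure (Time T) × (Time T → E), IsPolar f mρ.1 mρ.2 := by
  classical
  obtain ⟨b, -, hb⟩ := Time.exists_seq_exhausting T
  set m := pathMeasure f h.finite_variation h.right_continuous with hm
  choose ρ hρm hρi hρ0 hρ using fun n => exists_density_Iic hr1 hE h (b n)
  have hagree : ∀ᵐ s ∂m, ∀ k n, s ≤ b k → s ≤ b n → ρ k s = ρ n s := by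
    refine ae_all_iff.2 fun k => ae_all_iff.2 fun n => ?_
    have h1 : ρ k =ᵐ[m.restrict (Iic (b k ⊓ b n))] ρ n := by
      refine ae_eq_restrict_Iic_of_forall_setIntegral_Iic_eq
        ((hρi k).mono_set (Iic_subset_Iic.2 inf_le_left))
        ((hρi n).mono_set (Iic_subset_Iic.2 inf_le_right)) fun t ht => ?_
      rw [hρ k t (ht.trans inf_le_left), hρ n t (ht.trans inf_le_right)]
    filter_upwards [(ae_restrict_iff' measurableSet_Iic).1 h1] with s hs hk hn
    exact hs (le_inf hk hn)
  -- Gluing: each time uses the first interval containing it, and `hagree` makes the choice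
  -- immaterial almost everywhere.
  set g : Time T → E := fun s => ρ (Nat.find (hb s)) s with hg
  have hgρ : ∀ᵐ s ∂m, ∀ n, s ≤ b n → g s = ρ n s := by
    filter_upwards [hagree] with s hs n hn
    exact hs _ _ (Nat.find_spec (hb s)) hn
  have hgn : ∀ n, g =ᵐ[m.restrict (Iic (b n))] ρ n := fun n => by
    filter_upwards [ae_restrict_of_ae hgρ, ae_restrict_mem measurableSet_Iic] with s hs hsn
    exact hs n hsn
  have hU : ⋃ n, Iic (b n) = (univ : Set (Time T)) := eq_univ_of_forall fun t =>
    mem_iUnion.2 (hb t)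
  have hgm : AEStronglyMeasurable g m := by
    rw [← Measure.restrict_univ (μ := m), ← hU]
    exact aestronglyMeasurable_iUnion_iff.2 fun n =>
      (hρm n).aestronglyMeasurable.congr (hgn n).symm
  have hg0 : ∀ᵐ s ∂m, 0 ≤ g s := by
    rw [← Measure.restrict_univ (μ := m), ← hU, ae_restrict_iUnion_iff]
    intro n
    filter_upwards [hρ0 n, hgn n] with s h1 h2
    rwa [h2]
  -- `IsPolar` wants measurability and positivity everywhere, so a measurable representative is cut
  -- off where it leaves the cone.
  set σ : Time T → E := {s | 0 ≤ hgm.mk g s}.indicator (hgm.mk g) with hσ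
  have hσm : StronglyMeasurable σ := by
    refine hgm.stronglyMeasurable_mk.indicator ?_
    borelize E
    exact hgm.stronglyMeasurable_mk.measurable isClosed_Ici.measurableSet
  have hσg : σ =ᵐ[m] g := by
    filter_upwards [hgm.ae_eq_mk, hg0] with s h1 h2
    rw [hσ, indicator_of_mem (by simpa [← h1] using h2), h1]
  have hσρ : ∀ n, σ =ᵐ[m.restrict (Iic (b n))] ρ n := fun n =>
    EventuallyEq.trans (ae_restrict_of_ae hσg) (hgn n)
  refine ⟨(m, σ), pathMeasure_Iic _ _, hσm, fun t => ?_, fun t => ?_, fun t => ?_⟩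
  · exact indicator_apply_nonneg id
  · obtain ⟨n, hn⟩ := hb t
    exact IntegrableOn.mono_set ((hρi n).congr (hσρ n).symm) (Iic_subset_Iic.2 hn)
  · obtain ⟨n, hn⟩ := hb t
    rw [← hρ n t hn]
    exact integral_congr_ae (ae_restrict_of_ae_restrict_of_subset (Iic_subset_Iic.2 hn) (hσρ n))

end Existence

instance {D : Type*} [MeasurableSpace D] (μ : Measure D) (p : ℝ≥0∞) :
    IsOrderedModule ℝ (Lp ℝ p μ) where
  smul_le_smul_of_nonneg_left a ha x y hxy := by
    rw [← Lp.coeFn_le] at hxy ⊢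
    filter_upwards [Lp.coeFn_smul a x, Lp.coeFn_smul a y, hxy] with d h1 h2 h3
    rw [h1, h2]
    exact mul_le_mul_of_nonneg_left h3 ha
  smul_le_smul_of_nonneg_right x hx a b hab := by
    rw [← Lp.coeFn_nonneg] at hx
    rw [← Lp.coeFn_le]
    filter_upwards [Lp.coeFn_smul a x, Lp.coeFn_smul b x, hx] with d h1 h2 h3
    rw [h1, h2]
    exact mul_le_mul_of_nonneg_right hab h3

/-! ### Independence of integrals from the chosen measure and density. -/

section Transfer

variable {T : ℝ≥0∞} {E : Type*} [NormedAddCommGroup E] [NormedSpace ℝ E]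

theorem sigmaFinite_of_Iic_lt_top {m : Measure (Time T)} (h : ∀ t, m (Iic t) < ∞) :
    SigmaFinite m := by
  obtain ⟨b, -, hb⟩ := Time.exists_seq_exhausting T
  exact ⟨⟨⟨fun n => Iic (b n), fun _ => trivial, fun n => h _,
    eq_univ_of_forall fun t => mem_iUnion.2 (hb t)⟩⟩⟩

/-- Two locally integrable densities of the same path agree after passing to a common reference
measure. -/
theorem exists_common_density [CompleteSpace E] {m m' : Measure (Time T)} {ρ ρ' : Time T → E}
    (hm : ∀ t, m (Iic t) < ∞) (hm' : ∀ t, m' (Iic t) < ∞)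
    (h : ∀ t, IntegrableOn ρ (Iic t) m) (h' : ∀ t, IntegrableOn ρ' (Iic t) m')
    (heq : ∀ t, ∫ s in Iic t, ρ s ∂m = ∫ s in Iic t, ρ' s ∂m') :
    ∃ (M : Measure (Time T)) (a a' : Time T → ℝ≥0∞), Measurable a ∧ Measurable a' ∧
      m = M.withDensity a ∧ m' = M.withDensity a' ∧ (∀ᵐ s ∂M, a s < ∞) ∧ (∀ᵐ s ∂M, a' s < ∞) ∧
      ∀ᵐ s ∂M, (a s).toReal • ρ s = (a' s).toReal • ρ' s := by
  have := sigmaFinite_of_Iic_lt_top hm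
  have := sigmaFinite_of_Iic_lt_top hm'
  have hma := Measure.withDensity_rnDeriv_eq m (m + m')
    (Measure.le_add_right le_rfl : m ≤ m + m').absolutelyContinuous
  have hma' := Measure.withDensity_rnDeriv_eq m' (m + m')
    (Measure.le_add_left le_rfl : m' ≤ m + m').absolutelyContinuous
  have ha := Measure.measurable_rnDeriv m (m + m')
  have ha' := Measure.measurable_rnDeriv m' (m + m')
  have hlt : ∀ᵐ s ∂(m + m'), m.rnDeriv (m + m') s < ∞ := Measure.rnDeriv_lt_top m (m + m')
  have hlt' : ∀ᵐ s ∂(m + m'), m'.rnDeriv (m + m') s < ∞ := Measure.rnDeriv_lt_top m' (m + m')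
  refine ⟨m + m', m.rnDeriv (m + m'), m'.rnDeriv (m + m'), ha, ha', hma.symm, hma'.symm,
    hlt, hlt', ?_⟩
  -- With respect to `m + m'` both weighted densities have the same primitive.
  refine ae_eq_of_forall_setIntegral_Iic_eq (fun t => ?_) (fun t => ?_) fun t => ?_
  · have h1 := h t
    rw [← hma, IntegrableOn, restrict_withDensity measurableSet_Iic] at h1
    exact (integrable_withDensity_iff_integrable_smul' ha (ae_restrict_of_ae hlt)).1 h1
  · have h1 := h' t
    rw [← hma', IntegrableOn, restrict_withDensity measurableSet_Iic] at h1
    exact (integrable_withDensity_iff_integrable_smul' ha' (ae_restrict_of_ae hlt')).1 h1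
  · rw [← setIntegral_withDensity_eq_setIntegral_toReal_smul ha (ae_restrict_of_ae hlt) ρ
      measurableSet_Iic, ← setIntegral_withDensity_eq_setIntegral_toReal_smul ha'
      (ae_restrict_of_ae hlt') ρ' measurableSet_Iic]
    exact (congrArg (fun κ => ∫ s in Iic t, ρ s ∂κ) hma).trans ((heq t).trans
      (congrArg (fun κ => ∫ s in Iic t, ρ' s ∂κ) hma').symm)

/-- By linearity the Radon-Nikodym weights pass inside `L s`, and the two integrands agree almost
everywhere; no measurability of `L` is needed. -/
theorem setIntegral_clm_congr [CompleteSpace E] {m m' : Measure (Time T)} {ρ ρ' : Time T → E}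
    (hm : ∀ t, m (Iic t) < ∞) (hm' : ∀ t, m' (Iic t) < ∞)
    (h : ∀ t, IntegrableOn ρ (Iic t) m) (h' : ∀ t, IntegrableOn ρ' (Iic t) m')
    (heq : ∀ t, ∫ s in Iic t, ρ s ∂m = ∫ s in Iic t, ρ' s ∂m')
    (L : Time T → E →L[ℝ] E) (t : Time T) :
    ∫ s in Iic t, L s (ρ s) ∂m = ∫ s in Iic t, L s (ρ' s) ∂m' := by
  obtain ⟨M, a, a', ha, ha', rfl, rfl, hlt, hlt', hae⟩ := exists_common_density hm hm' h h' heq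
  rw [setIntegral_withDensity_eq_setIntegral_toReal_smul ha (ae_restrict_of_ae hlt) _
    measurableSet_Iic, setIntegral_withDensity_eq_setIntegral_toReal_smul ha'
    (ae_restrict_of_ae hlt') _ measurableSet_Iic]
  refine integral_congr_ae ?_
  filter_upwards [ae_restrict_of_ae hae] with s hs
  rw [← map_smul, ← map_smul, hs]

theorem lintegral_dual_congr [CompleteSpace E] {m m' : Measure (Time T)} {ρ ρ' : Time T → E}
    (hm : ∀ t, m (Iic t) < ∞) (hm' : ∀ t, m' (Iic t) < ∞)
    (h : ∀ t, IntegrableOn ρ (Iic t) m) (h' : ∀ t, IntegrableOn ρ' (Iic t) m')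
    (heq : ∀ t, ∫ s in Iic t, ρ s ∂m = ∫ s in Iic t, ρ' s ∂m')
    (φ : Time T → StrongDual ℝ E) :
    ∫⁻ s, ENNReal.ofReal (φ s (ρ s)) ∂m = ∫⁻ s, ENNReal.ofReal (φ s (ρ' s)) ∂m' := by
  obtain ⟨M, a, a', ha, ha', rfl, rfl, hlt, hlt', hae⟩ := exists_common_density hm hm' h h' heq
  rw [lintegral_withDensity_eq_lintegral_mul_non_measurable _ ha hlt,
    lintegral_withDensity_eq_lintegral_mul_non_measurable _ ha' hlt']
  refine lintegral_congr_ae ?_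
  filter_upwards [hae, hlt, hlt'] with s hs h1 h2
  have key : ∀ (c : ℝ≥0∞) (x : E), c < ∞ →
      c * ENNReal.ofReal (φ s x) = ENNReal.ofReal (φ s (c.toReal • x)) := by
    intro c x hc
    rw [map_smul, smul_eq_mul, ENNReal.ofReal_mul ENNReal.toReal_nonneg,
      ENNReal.ofReal_toReal hc.ne]
  rw [Pi.mul_apply, Pi.mul_apply, key _ _ h1, key _ _ h2, hs]

end Transfer

/-! ### Strongly continuous operator families applied to densities. -/

section StrongContinuity

variable {E : Type*} [NormedAddCommGroup E] [NormedSpace ℝ E] [CompleteSpace E]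

theorem exists_norm_le_of_strongly_continuous {Θ : ℝ → E →L[ℝ] E}
    (hΘ : ∀ x, Continuous fun s => Θ s x) (a b : ℝ) :
    ∃ C, ∀ s ∈ Icc a b, ‖Θ s‖ ≤ C := by
  obtain ⟨C, hC⟩ := banach_steinhaus (g := fun s : Icc a b => Θ s) fun x => by
    obtain ⟨C, hC⟩ := isCompact_Icc.exists_bound_of_continuousOn (hΘ x).continuousOn
    exact ⟨C, fun s => hC s s.2⟩
  exact ⟨C, fun s hs => hC ⟨s, hs⟩⟩

/-- Strong continuity becomes joint continuity because Banach-Steinhaus bounds `Θ` locally; this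
yields measurability of `s ↦ Θ s (ρ s)`. -/
theorem continuous_apply_of_strongly_continuous {Θ : ℝ → E →L[ℝ] E}
    (hΘ : ∀ x, Continuous fun s => Θ s x) : Continuous fun z : ℝ × E => Θ z.1 z.2 := by
  rw [continuous_iff_continuousAt]
  rintro ⟨s, x⟩
  obtain ⟨C, hC⟩ := exists_norm_le_of_strongly_continuous hΘ (s - 1) (s + 1)
  have h1 : Tendsto (fun z : ℝ × E => C * ‖z.2 - x‖ + ‖Θ z.1 x - Θ s x‖) (𝓝 (s, x)) (𝓝 0) := by
    have hc : Continuous fun z : ℝ × E => C * ‖z.2 - x‖ + ‖Θ z.1 x - Θ s x‖ :=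
      (continuous_const.mul (continuous_snd.sub continuous_const).norm).add
        (((hΘ x).comp continuous_fst).sub continuous_const).norm
    simpa using hc.tendsto (s, x)
  refine tendsto_iff_norm_sub_tendsto_zero.2 (squeeze_zero' (Eventually.of_forall fun _ =>
    norm_nonneg _) ?_ h1)
  have hev : ∀ᶠ z : ℝ × E in 𝓝 (s, x), z.1 ∈ Icc (s - 1) (s + 1) :=
    continuous_fst.continuousAt.eventually (Icc_mem_nhds (by linarith) (by linarith))
  filter_upwards [hev] with z hz
  calc ‖Θ z.1 z.2 - Θ s x‖ = ‖Θ z.1 (z.2 - x) + (Θ z.1 x - Θ s x)‖ := by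
        rw [map_sub]
        abel_nf
    _ ≤ ‖Θ z.1 (z.2 - x)‖ + ‖Θ z.1 x - Θ s x‖ := norm_add_le _ _
    _ ≤ _ := by
      gcongr
      exact (Θ z.1).le_of_opNorm_le (hC _ hz) _

variable {T : ℝ≥0∞}

theorem Time.continuous_toReal : Continuous (Time.toReal : Time T → ℝ) :=
  NNReal.continuous_coe.comp continuous_subtype_val

theorem Time.toReal_nonneg (t : Time T) : 0 ≤ t.toReal := NNReal.coe_nonneg _

theorem stronglyMeasurable_strongly_continuous_apply {Θ : ℝ → E →L[ℝ] E}
    (hΘ : ∀ x, Continuous fun s => Θ s x) {ρ : Time T → E} (hρ : StronglyMeasurable ρ)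
    {τ : Time T → ℝ} (hτ : Measurable τ) : StronglyMeasurable fun s => Θ (τ s) (ρ s) :=
  (continuous_apply_of_strongly_continuous hΘ).comp_stronglyMeasurable
    (hτ.stronglyMeasurable.prodMk hρ)

theorem integrableOn_strongly_continuous_apply {Θ : ℝ → E →L[ℝ] E}
    (hΘ : ∀ x, Continuous fun s => Θ s x) {ρ : Time T → E} (hρ : StronglyMeasurable ρ)
    {m : Measure (Time T)} (h : ∀ t, IntegrableOn ρ (Iic t) m) (t : Time T) :
    IntegrableOn (fun s => Θ s.toReal (ρ s)) (Iic t) m := by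
  obtain ⟨C, hC⟩ := exists_norm_le_of_strongly_continuous hΘ 0 t.toReal
  refine Integrable.mono' ((h t).norm.const_mul C)
    (stronglyMeasurable_strongly_continuous_apply hΘ hρ
      Time.continuous_toReal.measurable).aestronglyMeasurable ?_
  filter_upwards [ae_restrict_mem measurableSet_Iic] with s hs
  exact (Θ s.toReal).le_of_opNorm_le (hC _ ⟨s.toReal_nonneg, hs⟩) _

end StrongContinuity

/-! ### Associativity of integration against control paths. -/

section OpIntegral

variable {T : ℝ≥0∞} {E : Type*} [NormedAddCommGroup E] [NormedSpace ℝ E] [PartialOrder E]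

theorem isPolar_polar {f : Time T → E} (h : ∃ mρ : Measure (Time T) × (Time T → E),
    IsPolar f mρ.1 mρ.2) : IsPolar f (variationMeasure f) (polarDensity f) := by
  have : polar f = h.choose := dif_pos h
  rw [variationMeasure, polarDensity, this]
  exact h.choose_spec

theorem opIntegral_eq_zero {f : Time T → E} (h : ¬ ∃ mρ : Measure (Time T) × (Time T → E),
    IsPolar f mρ.1 mρ.2) (Θ : Time T → E →L[ℝ] E) (t : Time T) : opIntegral Θ f t = 0 := by
  have : polar f = (0, 0) := dif_neg h
  rw [opIntegral, variationMeasure, this]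
  simp

theorem IsPolar.measure_Iic_lt_top {f : Time T → E} {m : Measure (Time T)} {ρ : Time T → E}
    (h : IsPolar f m ρ) (hf : LocallyBoundedVariationOn f univ) (t : Time T) : m (Iic t) < ∞ := by
  rw [h.variation]
  exact ENNReal.add_lt_top.2 ⟨enorm_lt_top, (eVariationOn_Iic_ne_top hf t).lt_top⟩

/-- Every control path in `E` has a polar decomposition. -/
def HasPolarDecompositions (T : ℝ≥0∞) (E : Type*) [NormedAddCommGroup E] [NormedSpace ℝ E]
    [PartialOrder E] : Prop :=
  ∀ f : Time T → E, IsControlPath f → ∃ mρ : Measure (Time T) × (Time T → E), IsPolar f mρ.1 mρ.2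

variable [IsOrderedAddMonoid E] [IsOrderedModule ℝ E] [ClosedIciTopology E] [CompleteSpace E]
  {Θ : ℝ → E →L[ℝ] E}

theorem isControlPath_opIntegral (hE : HasPolarDecompositions T E)
    (hΘ : ∀ x, Continuous fun s => Θ s x) (hpos : ∀ s x, 0 ≤ x → 0 ≤ Θ s x)
    {f : Time T → E} (hf : IsControlPath f) :
    IsControlPath (opIntegral (fun s => Θ s.toReal) f) := by
  have hp := isPolar_polar (hE f hf)
  exact isControlPath_setIntegral_Iic
    (integrableOn_strongly_continuous_apply hΘ hp.measurable hp.integrable)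
    fun s => hpos _ _ (hp.nonneg s)

/-- The left side uses the polar pair of the inner integral, the right side the density `Θρ` with
respect to `|f|`. Both represent the same path, so the transfer lemma applies. -/
theorem opIntegral_opIntegral (hE : HasPolarDecompositions T E)
    (hΘ : ∀ x, Continuous fun s => Θ s x) (hpos : ∀ s x, 0 ≤ x → 0 ≤ Θ s x)
    {f : Time T → E} (hf : IsControlPath f) (L : Time T → E →L[ℝ] E) (t : Time T) :
    opIntegral L (opIntegral (fun s => Θ s.toReal) f) t =
      opIntegral (fun s => (L s).comp (Θ s.toReal)) f t := by
  have hp := isPolar_polar (hE f hf)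
  have hg := isControlPath_opIntegral hE hΘ hpos hf
  have hq := isPolar_polar (hE _ hg)
  exact setIntegral_clm_congr (hq.measure_Iic_lt_top hg.finite_variation)
    (hp.measure_Iic_lt_top hf.finite_variation) hq.integrable
    (integrableOn_strongly_continuous_apply hΘ hp.measurable hp.integrable) hq.density L t

theorem pairIntegral_opIntegral (hE : HasPolarDecompositions T E)
    (hΘ : ∀ x, Continuous fun s => Θ s x) (hpos : ∀ s x, 0 ≤ x → 0 ≤ Θ s x)
    {f : Time T → E} (hf : IsControlPath f) (φ : Time T → StrongDual ℝ E) :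
    pairIntegral φ (opIntegral (fun s => Θ s.toReal) f) =
      pairIntegral (fun s => (φ s).comp (Θ s.toReal)) f := by
  have hp := isPolar_polar (hE f hf)
  have hg := isControlPath_opIntegral hE hΘ hpos hf
  have hq := isPolar_polar (hE _ hg)
  exact lintegral_dual_congr (hq.measure_Iic_lt_top hg.finite_variation)
    (hp.measure_Iic_lt_top hf.finite_variation) hq.integrable
    (integrableOn_strongly_continuous_apply hΘ hp.measurable hp.integrable) hq.density φ

end OpIntegral

/-! ### Riemann sums for operator integrals. -/

section RiemannSums

variable {T : ℝ≥0∞} {E : Type*} [NormedAddCommGroup E] [NormedSpace ℝ E]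

/-- The time `min (k / N) t`. -/
noncomputable def gridTime (t : Time T) (N k : ℕ) : Time T :=
  ⟨min ((k : ℝ≥0) / N) t, le_trans (ENNReal.coe_le_coe.2 (min_le_right _ _)) t.2⟩

theorem gridTime_le (t : Time T) (N k : ℕ) : gridTime t N k ≤ t :=
  Subtype.coe_le_coe.1 (min_le_right _ _)

theorem gridTime_mono (t : Time T) (N : ℕ) {k l : ℕ} (h : k ≤ l) :
    gridTime t N k ≤ gridTime t N l :=
  Subtype.coe_le_coe.1 (min_le_min_right _ (by gcongr))

/-- Identifies the grid cell containing `s` by the index `⌈sN⌉`. -/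
theorem le_gridTime_iff {s t : Time T} {N k : ℕ} (hN : 0 < N) :
    s ≤ gridTime t N k ↔ ⌈s.toReal * N⌉₊ ≤ k ∧ s ≤ t := by
  have hN' : (0 : ℝ) < N := Nat.cast_pos.2 hN
  rw [Nat.ceil_le, ← le_div_iff₀ hN', ← Subtype.coe_le_coe, gridTime, le_min_iff,
    Subtype.coe_le_coe, ← NNReal.coe_le_coe]
  push_cast
  rfl

theorem gridTime_ceil (t : Time T) {N : ℕ} (hN : 0 < N) : gridTime t N ⌈t.toReal * N⌉₊ = t :=
  le_antisymm (gridTime_le _ _ _) ((le_gridTime_iff hN).2 ⟨le_rfl, le_rfl⟩)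

/-- The Riemann sums of `∫_{[0,t]} Θ(s) df_s` with mesh `1 / N`. -/
noncomputable def riemannSum (Θ : ℝ → E →L[ℝ] E) (f : Time T → E) (t : Time T) (N K : ℕ) : E :=
  Θ 0 (f (gridTime t N 0)) + ∑ k ∈ Finset.range K,
    Θ (((k + 1 : ℕ) : ℝ) / N) (f (gridTime t N (k + 1)) - f (gridTime t N k))

variable [CompleteSpace E] {Θ : ℝ → E →L[ℝ] E} {m : Measure (Time T)} {ρ : Time T → E}

theorem measurable_ceil_mul_div (N : ℕ) :
    Measurable fun s : Time T => (⌈s.toReal * N⌉₊ : ℝ) / N := by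
  have h : Measurable fun s : Time T => ⌈s.toReal * N⌉₊ :=
    Nat.measurable_ceil.comp (Time.continuous_toReal.measurable.mul_const _)
  exact (measurable_from_top.comp h).div_const _

theorem exists_bound_ceil_mul_div (hΘ : ∀ x, Continuous fun s => Θ s x) (t : Time T) :
    ∃ C, ∀ N : ℕ, 0 < N → ∀ s ≤ t, ‖Θ ((⌈s.toReal * N⌉₊ : ℝ) / N)‖ ≤ C := by
  -- The right endpoint `⌈sN⌉ / N` can exceed `t`, but by at most `1 / N ≤ 1`.
  obtain ⟨C, hC⟩ := exists_norm_le_of_strongly_continuous hΘ 0 (t.toReal + 1)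
  refine ⟨C, fun N hN s hs => hC _ ⟨by positivity, ?_⟩⟩
  have hN' : (1 : ℝ) ≤ N := Nat.one_le_cast.2 hN
  have h1 := (Nat.ceil_lt_add_one (mul_nonneg s.toReal_nonneg (Nat.cast_nonneg N))).le
  have h2 : s.toReal ≤ t.toReal := hs
  rw [div_le_iff₀ (by linarith)]
  nlinarith

theorem integrableOn_ceil_mul_div (hΘ : ∀ x, Continuous fun s => Θ s x)
    (hρ : StronglyMeasurable ρ) (h : ∀ t, IntegrableOn ρ (Iic t) m) {N : ℕ} (hN : 0 < N)
    (t : Time T) :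
    IntegrableOn (fun s : Time T => Θ ((⌈s.toReal * N⌉₊ : ℝ) / N) (ρ s)) (Iic t) m := by
  obtain ⟨C, hC⟩ := exists_bound_ceil_mul_div hΘ t
  refine Integrable.mono' ((h t).norm.const_mul C)
    (stronglyMeasurable_strongly_continuous_apply hΘ hρ
      (measurable_ceil_mul_div N)).aestronglyMeasurable ?_
  filter_upwards [ae_restrict_mem measurableSet_Iic] with s hs
  exact (Θ _).le_of_opNorm_le (hC N hN s hs) _

/-- Rounding times up to the grid makes the operator constant on each cell, where it can be pulled
out of the integral. -/
theorem setIntegral_ceil_mul_div (hΘ : ∀ x, Continuous fun s => Θ s x)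
    (hρ : StronglyMeasurable ρ) (h : ∀ t, IntegrableOn ρ (Iic t) m) {f : Time T → E}
    (hf : ∀ t, ∫ s in Iic t, ρ s ∂m = f t) {N : ℕ} (hN : 0 < N) (t : Time T) (K : ℕ) :
    ∫ s in Iic (gridTime t N K), Θ ((⌈s.toReal * N⌉₊ : ℝ) / N) (ρ s) ∂m =
      riemannSum Θ f t N K := by
  have hint := integrableOn_ceil_mul_div hΘ hρ h hN
  induction K with
  | zero =>
    have h1 : ∀ s ∈ Iic (gridTime t N 0), Θ ((⌈s.toReal * N⌉₊ : ℝ) / N) (ρ s) = Θ 0 (ρ s) := by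
      intro s hs
      rw [Nat.le_zero.1 ((le_gridTime_iff hN).1 hs).1, Nat.cast_zero, zero_div]
    rw [setIntegral_congr_fun measurableSet_Iic h1, (Θ 0).integral_comp_comm (h _), hf]
    simp [riemannSum]
  | succ K ih =>
    have hle := gridTime_mono t N K.le_succ
    have h1 : ∀ s ∈ Ioc (gridTime t N K) (gridTime t N (K + 1)),
        Θ ((⌈s.toReal * N⌉₊ : ℝ) / N) (ρ s) = Θ (((K + 1 : ℕ) : ℝ) / N) (ρ s) := by
      intro s hs
      have h2 := (le_gridTime_iff hN).1 hs.2
      have h3 : ¬ (⌈s.toReal * N⌉₊ ≤ K) := fun hcon =>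
        (not_le_of_gt hs.1) ((le_gridTime_iff hN).2 ⟨hcon, h2.2⟩)
      rw [show ⌈s.toReal * N⌉₊ = K + 1 by omega]
    have h4 := setIntegral_Iic_sub_setIntegral_Iic hint hle
    rw [setIntegral_congr_fun measurableSet_Ioc h1,
      (Θ _).integral_comp_comm ((h _).mono_set Ioc_subset_Iic_self),
      ← setIntegral_Iic_sub_setIntegral_Iic h hle, hf, hf, ih, sub_eq_iff_eq_add'] at h4
    rw [h4, riemannSum, riemannSum, Finset.sum_range_succ, add_assoc]

theorem tendsto_riemannSum (hΘ : ∀ x, Continuous fun s => Θ s x)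
    (hρ : StronglyMeasurable ρ) (h : ∀ t, IntegrableOn ρ (Iic t) m) {f : Time T → E}
    (hf : ∀ t, ∫ s in Iic t, ρ s ∂m = f t) (t : Time T) :
    Tendsto (fun n : ℕ => riemannSum Θ f t (n + 1) ⌈t.toReal * (n + 1 : ℕ)⌉₊) atTop
      (𝓝 (∫ s in Iic t, Θ s.toReal (ρ s) ∂m)) := by
  have heq : ∀ n : ℕ, riemannSum Θ f t (n + 1) ⌈t.toReal * (n + 1 : ℕ)⌉₊ =
      ∫ s in Iic t, Θ ((⌈s.toReal * (n + 1 : ℕ)⌉₊ : ℝ) / (n + 1 : ℕ)) (ρ s) ∂m := fun n => by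
    rw [← setIntegral_ceil_mul_div hΘ hρ h hf n.succ_pos, gridTime_ceil t n.succ_pos]
  simp_rw [heq]
  obtain ⟨C, hC⟩ := exists_bound_ceil_mul_div hΘ t
  refine tendsto_integral_of_dominated_convergence (fun s => C * ‖ρ s‖)
    (fun n => (integrableOn_ceil_mul_div hΘ hρ h n.succ_pos t).aestronglyMeasurable)
    ((h t).norm.const_mul C) (fun n => ?_) (Eventually.of_forall fun s => ?_)
  · filter_upwards [ae_restrict_mem measurableSet_Iic] with s hs
    exact (Θ _).le_of_opNorm_le (hC _ n.succ_pos s hs) _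
  · have h1 := (tendsto_nat_ceil_mul_div_atTop s.toReal_nonneg).comp
      (tendsto_natCast_atTop_atTop.comp (tendsto_add_atTop_nat 1))
    exact ((hΘ (ρ s)).tendsto _).comp h1

end RiemannSums

/-! ### Adaptedness and cost of transformed controls. -/

section Controls

variable {T : ℝ≥0∞} {Ω : Type*} {mΩ : MeasurableSpace Ω} {P : Measure Ω}
  {𝓕 : Filtration (Time T) mΩ}
  {E : Type*} [NormedAddCommGroup E] [NormedSpace ℝ E] [CompleteSpace E] [PartialOrder E]
  [IsOrderedAddMonoid E] [IsOrderedModule ℝ E] [ClosedIciTopology E]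
  {Θ : ℝ → E →L[ℝ] E} {ν : Time T → Ω → E}

/-- The pathwise choice of `polar` gives no measurability in `ω`; the Riemann sums do, since they
involve `ν` only at grid times up to `t`. -/
theorem stronglyAdapted_opIntegral (hE : HasPolarDecompositions T E) (h𝓕 : UsualConditions 𝓕 P)
    (hΘ : ∀ x, Continuous fun s => Θ s x) (hν : IsControl 𝓕 P ν) :
    StronglyAdapted 𝓕 fun t ω => opIntegral (fun s => Θ s.toReal) (fun s => ν s ω) t := by
  intro t
  set G : Set Ω := {ω | IsControlPath fun s => ν s ω} with hG
  -- The complement of `G` is null, hence in `𝓕 t` by completeness.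
  have hGm : MeasurableSet[𝓕 t] G := by
    have := h𝓕.complete Gᶜ (ae_iff.1 hν.paths) t
    simpa using this.compl
  have hνm : ∀ s ≤ t, StronglyMeasurable[𝓕 t] (ν s) := fun s hs =>
    (hν.adapted s).mono (𝓕.mono hs)
  have hRm : ∀ N K, StronglyMeasurable[𝓕 t] fun ω => riemannSum Θ (fun s => ν s ω) t N K := by
    intro N K
    refine StronglyMeasurable.add ((Θ 0).continuous.comp_stronglyMeasurable
      (hνm _ (gridTime_le t N 0))) ?_
    refine Finset.stronglyMeasurable_fun_sum _ fun k _ => ?_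
    exact (Θ _).continuous.comp_stronglyMeasurable
      ((hνm _ (gridTime_le t N (k + 1))).sub (hνm _ (gridTime_le t N k)))
  refine stronglyMeasurable_of_tendsto atTop
    (fun n : ℕ => (hRm (n + 1) ⌈t.toReal * (n + 1 : ℕ)⌉₊).indicator hGm) ?_
  rw [tendsto_pi_nhds]
  intro ω
  by_cases hω : ω ∈ G
  · simp only [indicator_of_mem hω]
    have hp := isPolar_polar (hE _ hω)
    exact tendsto_riemannSum hΘ hp.measurable hp.integrable hp.density t
  -- Off `G` there is no polar pair, so the integral is `0`, matching the truncated sums.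
  · simp only [indicator_of_notMem hω]
    rw [opIntegral_eq_zero]
    · exact tendsto_const_nhds
    · rintro ⟨mρ, h⟩
      exact hω h.isControlPath

theorem isControl_opIntegral (hE : HasPolarDecompositions T E) (h𝓕 : UsualConditions 𝓕 P)
    (hΘ : ∀ x, Continuous fun s => Θ s x) (hpos : ∀ s x, 0 ≤ x → 0 ≤ Θ s x)
    (hν : IsControl 𝓕 P ν) :
    IsControl 𝓕 P fun t ω => opIntegral (fun s => Θ s.toReal) (fun s => ν s ω) t where
  adapted := stronglyAdapted_opIntegral hE h𝓕 hΘ hν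
  paths := hν.paths.mono fun _ hω => isControlPath_opIntegral hE hΘ hpos hω

theorem totalCost_opIntegral (hE : HasPolarDecompositions T E)
    (hΘ : ∀ x, Continuous fun s => Θ s x) (hpos : ∀ s x, 0 ≤ x → 0 ≤ Θ s x)
    (Φ : Time T → Ω → StrongDual ℝ E) {ω : Ω} (hω : IsControlPath fun s => ν s ω) :
    totalCost Φ (fun t ω => opIntegral (fun s => Θ s.toReal) (fun s => ν s ω) t) ω =
      totalCost (fun t ω => (Φ t ω).comp (Θ t.toReal)) ν ω :=
  pairIntegral_opIntegral hE hΘ hpos hω fun t => Φ t ω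

end Controls

/-! ### Equivalence of the two control problems. -/

section Reformulation

variable {T : ℝ≥0∞} {Ω : Type*} {mΩ : MeasurableSpace Ω} {P : Measure Ω}
  {𝓕 : Filtration (Time T) mΩ}
  {E : Type*} [NormedAddCommGroup E] [NormedSpace ℝ E] [PartialOrder E]
  {A : E →ₗ.[ℝ] E} {U : ℝ → E →L[ℝ] E} {ν : Time T → Ω → E} {Φ : Time T → Ω → StrongDual ℝ E}
  {q : Measure (Time T)} {profit : Ω → Time T → E → ℝ≥0} {y : E}

theorem GeneratesPositiveGroup.comp_neg (hA : GeneratesPositiveGroup A U) (t : ℝ) :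
    (U t).comp (U (-t)) = ContinuousLinearMap.id ℝ E := by
  rw [← hA.map_add, add_neg_cancel, hA.map_zero]

/-- The control `ν̂_t = ∫_0^t e^{-sA} dν_s` obtained from `ν`. -/
noncomputable def hatOfControl (U : ℝ → E →L[ℝ] E) (ν : Time T → Ω → E) (t : Time T) (ω : Ω) : E :=
  opIntegral (fun s => U (-s.toReal)) (fun s => ν s ω) t

theorem netProfit_congr {Φ' : Time T → Ω → StrongDual ℝ E} {Y Y' ν' : Time T → Ω → E}
    (hY : ∀ᵐ ω ∂P, ∀ t, Y t ω = Y' t ω) (hc : ∀ᵐ ω ∂P, totalCost Φ ν ω = totalCost Φ' ν' ω) :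
    netProfit P q profit Φ Y ν = netProfit P q profit Φ' Y' ν' := by
  rw [netProfit, netProfit, lintegral_congr_ae hc]
  congr 2
  refine lintegral_congr_ae ?_
  filter_upwards [hY] with ω hω
  simp_rw [hω]

variable [CompleteSpace E]

/-- Factor `e^{(t-s)A} = e^{tA} e^{-sA}` and pull `e^{tA}` out. Both integrals use the polar pair of
`ν`, so no change of density is needed. -/
theorem mildState_eq_hatState_hatOfControl (hE : HasPolarDecompositions T E)
    (hA : GeneratesPositiveGroup A U) {ω : Ω} (hω : IsControlPath fun s => ν s ω) (y : E)
    (t : Time T) : mildState U y ν t ω = U t.toReal (hatState y (hatOfControl U ν) t ω) := by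
  have hp := isPolar_polar (hE _ hω)
  have hΘ : ∀ x, Continuous fun s : ℝ => U (-s) x := fun x =>
    (hA.strong_continuous x).comp continuous_neg
  have h1 : opIntegral (fun s => U (t.toReal - s.toReal)) (fun s => ν s ω) t =
      U t.toReal (hatOfControl U ν t ω) := by
    rw [hatOfControl, opIntegral, opIntegral, ← (U t.toReal).integral_comp_comm
      (integrableOn_strongly_continuous_apply hΘ hp.measurable hp.integrable t)]
    simp_rw [sub_eq_add_neg, hA.map_add]
    rfl
  rw [mildState, hatState, map_add, h1]

variable [IsOrderedAddMonoid E] [IsOrderedModule ℝ E] [ClosedIciTopology E]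

/-- After associativity the integrand operator is `e^{(t-s)A} e^{sA} = e^{tA}`, constant in `s`. -/
theorem mildState_controlOfHat (hE : HasPolarDecompositions T E) (hA : GeneratesPositiveGroup A U)
    {ω : Ω} (hω : IsControlPath fun s => ν s ω) (y : E) (t : Time T) :
    mildState U y (controlOfHat U ν) t ω = U t.toReal (hatState y ν t ω) := by
  have h1 := opIntegral_opIntegral hE hA.strong_continuous hA.positive hω
    (fun s => U (t.toReal - s.toReal)) t
  have h2 : ∀ s : Time T, (U (t.toReal - s.toReal)).comp (U s.toReal) = U t.toReal := fun s => by
    rw [← hA.map_add, sub_add_cancel]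
  simp_rw [h2] at h1
  have hp := isPolar_polar (hE _ hω)
  have h3 : opIntegral (fun _ => U t.toReal) (fun s => ν s ω) t = U t.toReal (ν t ω) := by
    rw [opIntegral, (U t.toReal).integral_comp_comm (hp.integrable t), hp.density]
  rw [mildState, hatState, map_add]
  exact congrArg _ (h1.trans h3)

theorem totalCost_controlOfHat (hE : HasPolarDecompositions T E) (hA : GeneratesPositiveGroup A U)
    {ω : Ω} (hω : IsControlPath fun s => ν s ω) :
    totalCost Φ (controlOfHat U ν) ω = totalCost (adjointCost U Φ) ν ω :=
  totalCost_opIntegral hE hA.strong_continuous hA.positive Φ hω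

theorem totalCost_hatOfControl (hE : HasPolarDecompositions T E) (hA : GeneratesPositiveGroup A U)
    {ω : Ω} (hω : IsControlPath fun s => ν s ω) :
    totalCost (adjointCost U Φ) (hatOfControl U ν) ω = totalCost Φ ν ω := by
  refine (totalCost_opIntegral (Θ := fun s => U (-s)) hE
    (fun x => (hA.strong_continuous x).comp continuous_neg)
    (fun s => hA.positive (-s)) (adjointCost U Φ) hω).trans ?_
  have h : (fun (t : Time T) (ω : Ω) => (adjointCost U Φ t ω).comp (U (-t.toReal))) = Φ := by
    funext t ω
    rw [adjointCost, ContinuousLinearMap.comp_assoc, hA.comp_neg, ContinuousLinearMap.comp_id]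
  rw [h]

theorem controlOfHat_mem_admissible (hE : HasPolarDecompositions T E)
    (h𝓕 : UsualConditions 𝓕 P) (hA : GeneratesPositiveGroup A U)
    (hν : ν ∈ admissible 𝓕 P (adjointCost U Φ)) : controlOfHat U ν ∈ admissible 𝓕 P Φ := by
  refine ⟨isControl_opIntegral hE h𝓕 hA.strong_continuous hA.positive hν.1, ?_⟩
  rw [lintegral_congr_ae (hν.1.paths.mono fun ω hω => totalCost_controlOfHat hE hA hω)]
  exact hν.2

theorem hatOfControl_mem_admissible (hE : HasPolarDecompositions T E)
    (h𝓕 : UsualConditions 𝓕 P) (hA : GeneratesPositiveGroup A U)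
    (hν : ν ∈ admissible 𝓕 P Φ) : hatOfControl U ν ∈ admissible 𝓕 P (adjointCost U Φ) := by
  refine ⟨isControl_opIntegral (Θ := fun s => U (-s)) hE h𝓕
    (fun x => (hA.strong_continuous x).comp continuous_neg) (fun s => hA.positive (-s)) hν.1, ?_⟩
  rw [lintegral_congr_ae (hν.1.paths.mono fun ω hω => totalCost_hatOfControl hE hA hω)]
  exact hν.2

theorem performance_controlOfHat (hE : HasPolarDecompositions T E)
    (hA : GeneratesPositiveGroup A U) (hν : IsControl 𝓕 P ν) :
    performance P q profit Φ U y (controlOfHat U ν) = hatPerformance P q profit Φ U y ν :=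
  netProfit_congr (hν.paths.mono fun _ hω t => mildState_controlOfHat hE hA hω y t)
    (hν.paths.mono fun _ hω => totalCost_controlOfHat hE hA hω)

theorem hatPerformance_hatOfControl (hE : HasPolarDecompositions T E)
    (hA : GeneratesPositiveGroup A U) (hν : IsControl 𝓕 P ν) :
    hatPerformance P q profit Φ U y (hatOfControl U ν) = performance P q profit Φ U y ν :=
  netProfit_congr
    (hν.paths.mono fun _ hω t => (mildState_eq_hatState_hatOfControl hE hA hω y t).symm)
    (hν.paths.mono fun _ hω => totalCost_hatOfControl hE hA hω)

/-- Equality of the criteria in both directions suffices; that the two maps are mutually inverse is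
never needed. -/
theorem IsOptimal.controlOfHat (hE : HasPolarDecompositions T E) (h𝓕 : UsualConditions 𝓕 P)
    (hA : GeneratesPositiveGroup A U)
    (hν : IsOptimal (admissible 𝓕 P (adjointCost U Φ)) (hatPerformance P q profit Φ U y) ν) :
    IsOptimal (admissible 𝓕 P Φ) (performance P q profit Φ U y) (controlOfHat U ν) := by
  have hmem := controlOfHat_mem_admissible hE h𝓕 hA hν.1
  refine ⟨hmem, le_antisymm (le_iSup₂_of_le _ hmem le_rfl) (iSup₂_le fun ν' hν' => ?_)⟩
  rw [performance_controlOfHat hE hA hν.1.1, hν.2, ← hatPerformance_hatOfControl hE hA hν'.1]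
  exact le_iSup₂_of_le _ (hatOfControl_mem_admissible hE h𝓕 hA hν') le_rfl

end Reformulation

/-- The range `1 < p < ∞` enters the control argument only through this property. -/
theorem hasPolarDecompositions_Lp (T : ℝ≥0∞) {D : Type*} [MeasurableSpace D] (μ : Measure D)
    {p : ℝ≥0∞} [Fact (1 ≤ p)] (hp_one : 1 < p) (hp_top : p ≠ ∞) :
    HasPolarDecompositions T (Lp ℝ p μ) := by
  have hr : 1 ≤ p.toReal := by
    rw [← ENNReal.toReal_one]
    exact ENNReal.toReal_mono hp_top hp_one.le
  exact fun _ hf => hf.exists_isPolar hr (uniformlyConvexPower_Lp hp_one hp_top)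

end SingularControl

theorem proposition4p2 {D : Type*} [MeasurableSpace D] (μ : Measure D)
    (p : ℝ≥0∞) [Fact (1 ≤ p)] (hp_one : 1 < p) (hp_top : p ≠ ∞)
    (A : Lp ℝ p μ →ₗ.[ℝ] Lp ℝ p μ) (U : ℝ → Lp ℝ p μ →L[ℝ] Lp ℝ p μ)
    (hA : SingularControl.GeneratesPositiveGroup A U)
    (T : ℝ≥0∞) {Ω : Type*} {mΩ : MeasurableSpace Ω} (P : Measure Ω) [IsProbabilityMeasure P]
    (𝓕 : Filtration (SingularControl.Time T) mΩ) (h𝓕 : SingularControl.UsualConditions 𝓕 P)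
    (q : Measure (SingularControl.Time T)) [IsFiniteMeasure q]
    (profit : Ω → SingularControl.Time T → Lp ℝ p μ → ℝ≥0)
    (hprofit : SingularControl.IsProfitFunction profit)
    (Φ : SingularControl.Time T → Ω → StrongDual ℝ (Lp ℝ p μ))
    (hΦ : SingularControl.IsCostProcess 𝓕 P Φ)
    (y : Lp ℝ p μ) (hy : 0 ≤ y)
    (νhat : SingularControl.Time T → Ω → Lp ℝ p μ)
    (hopt : SingularControl.IsOptimal
      (SingularControl.admissible 𝓕 P (SingularControl.adjointCost U Φ))
      (SingularControl.hatPerformance P q profit Φ U y) νhat) :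
    SingularControl.IsOptimal (SingularControl.admissible 𝓕 P Φ)
      (SingularControl.performance P q profit Φ U y) (SingularControl.controlOfHat U νhat) ∧
    ∀ᵐ ω ∂P, ∀ t : SingularControl.Time T,
      SingularControl.mildState U y (SingularControl.controlOfHat U νhat) t ω =
        U t.toReal (SingularControl.hatState y νhat t ω) := by
  have hE := SingularControl.hasPolarDecompositions_Lp T μ hp_one hp_top
  exact ⟨hopt.controlOfHat hE h𝓕 hA, hopt.1.1.paths.mono fun _ hω =>
    SingularControl.mildState_controlOfHat hE hA hω y⟩
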